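/- Let $L,\tau,\eta,\kappa,\beta>0$ and let $m,\delta,p\in W^{1,\infty}(0,L)$ be real-valued (identified with their continuous representatives on $[0,L]$) with $m(x),\delta(x),p(x)>0$ for all $x\in[0,L]$. Consider, for $x\in(0,L)$, $t\ge 0$, the system $$m\,u_{tt}-(p\,u_x+2\delta\,u_{xt})_x+\eta\,\theta_x=0,\qquad \theta_t+\kappa\,q_x+\eta\,u_{xt}=0,\qquad \tau\,q_t+\beta\,q+\kappa\,\theta_x=0,$$ with $u=0$ at $x=0,L$ and with either (1) $\theta=0$ at $x=0,L$, or (2) $q=0$ at $x=0,L$. Let $\mathcal H=H^1_0(0,L)\times L^2(0,L)\times L^2(0,L)\times L^2(0,L)$ (complex-valued functions), with the inner product $$\langle U^1,U^2\rangle_{\mathcal H}=\int_0^L p\,u^1_x\overline{u^2_x}\,dx+\int_0^L m\,w^1\overline{w^2}\,dx+\int_0^L\theta^1\overline{\theta^2}\,dx+\tau\int_0^L q^1\overline{q^2}\,dx,\qquad U^i=(u^i,w^i,\theta^i,q^i).$$ Let $$\mathcal D_1=\{(u,w,\theta,q)\in\mathcal H:\ w\in H^1_0,\ p\,u_x+2\delta\,w_x\in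 H^1,\ \theta\in H^1_0,\ q\in H^1\},$$ $$\mathcal D_2=\{(u,w,\theta,q)\in\mathcal H:\ w\in H^1_0,\ p\,u_x+2\delta\,w_x\in H^1,\ \theta\in H^1,\ q\in H^1_0\},$$ and let $\mathcal A_i:\mathcal D_i\to\mathcal H$, $i=1,2$, be given by $$\mathcal A_i(u,w,\theta,q)=\Big(w,\ \tfrac1m\big(p\,u_x+2\delta\,w_x-\eta\,\theta\big)_x,\ -\kappa\,q_x-\eta\,w_x,\ -\tfrac1\tau(\kappa\,\theta_x+\beta\,q)\Big).$$ With $w=u_t$ and $U=(u,w,\theta,q)$, the system with boundary conditions ($i$) is the Cauchy problem $U'=\mathcal A_iU$, $U(0)=U_0$. A mild solution of it is a function $U\in C([0,\infty);\mathcal H)$ such that, for all $t\ge0$, $\int_0^tU(s)\,ds\in\mathcal D_i$ and $U(t)=U_0+\mathcal A_i\int_0^tU(s)\,ds$. Theorem. Let $i\in\{1,2\}$. For every $U_0\in\mathcal H$ there is a unique mild solution $U\in C([0,\infty);\mathcal H)$. If moreover $U_0\in\mathcal D_i$, then $U\in C^1([0,\infty);\mathcal H)\cap C([0,\infty);\mathcal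 D_i)$, where $\mathcal D_i$ carries the graph norm of $\mathcal A_i$, and $U$ solves the problem in the strong sense: $U(0)=U_0$ and $U'(t)=\mathcal A_iU(t)$ for all $t\ge0$. -/

import Mathlib

open MeasureTheory Set
open scoped ContDiff ComplexConjugate NNReal ENNReal

noncomputable section

namespace Cattaneo

/-! ### Sobolev spaces on the interval `(0, L)` -/

/-- Lebesgue measure on `(0, L)`. -/
abbrev vol (L : ℝ) : Measure ℝ := volume.restrict (Ioo 0 L)

/-- The complex space `L²(0, L)`. -/
abbrev L2 (L : ℝ) : Type := Lp ℂ 2 (vol L)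

/-- Test functions: smooth, with compact support contained in `(0, L)`. -/
structure IsTest {𝕜 : Type*} [RCLike 𝕜] (L : ℝ) (φ : ℝ → 𝕜) : Prop where
  smooth : ContDiff ℝ ∞ φ
  compact : HasCompactSupport φ
  supp : tsupport φ ⊆ Ioo 0 L

/-- `g` is a weak derivative of `u` on `(0, L)`. -/
def HasWeakDeriv {𝕜 : Type*} [RCLike 𝕜] (L : ℝ) (u g : ℝ → 𝕜) : Prop :=
  ∀ φ : ℝ → 𝕜, IsTest L φ → ∫ x, u x * deriv φ x ∂(vol L) = -∫ x, g x * φ x ∂(vol L)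

/-- The real-valued Sobolev space `W^{1,∞}(0, L)`. -/
def MemW1Inf (L : ℝ) (a : ℝ → ℝ) : Prop :=
  MemLp a ∞ (vol L) ∧ ∃ g : ℝ → ℝ, MemLp g ∞ (vol L) ∧ HasWeakDeriv L a g

section Sobolev

variable {L : ℝ}

lemma IsTest.memLp {φ : ℝ → ℂ} (h : IsTest L φ) : MemLp φ 2 (vol L) :=
  (h.smooth.continuous.memLp_of_hasCompactSupport h.compact).restrict _

lemma IsTest.deriv {φ : ℝ → ℂ} (h : IsTest L φ) : IsTest L (deriv φ) where
  smooth := (contDiff_infty_iff_deriv.mp h.smooth).2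
  compact := h.compact.deriv
  supp := (closure_mono (support_deriv_subset (f := φ))).trans (by
    simpa [tsupport] using h.supp)

lemma integrable_mul_coe {ψ : ℝ → ℂ} (hψ : MemLp ψ 2 (vol L)) (f : L2 L) :
    Integrable (fun x => f x * ψ x) (vol L) := (Lp.memLp f).integrable_mul hψ

lemma continuous_integral_mul {ψ : ℝ → ℂ} (hψ : MemLp ψ 2 (vol L)) :
    Continuous fun f : L2 L => ∫ x, f x * ψ x ∂(vol L) := by
  have h : (fun f : L2 L => ∫ x, f x * ψ x ∂(vol L)) =
      fun f : L2 L => inner ℂ (hψ.star.toLp (star ψ)) f := by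
    funext f
    rw [L2.inner_def]
    refine integral_congr_ae ?_
    filter_upwards [hψ.star.coeFn_toLp] with x hx
    simp [hx, RCLike.inner_apply]
  rw [h]
  fun_prop

/-- The graph of the weak derivative on `L²(0, L)`. -/
def weakGraph (L : ℝ) : Submodule ℂ (L2 L × L2 L) where
  carrier := {z | HasWeakDeriv L z.1 z.2}
  zero_mem' := by
    intro φ _
    have h0 : ((0 : L2 L) : ℝ → ℂ) =ᵐ[vol L] 0 := Lp.coeFn_zero _ _ _
    rw [integral_eq_zero_of_ae, integral_eq_zero_of_ae, neg_zero]
    all_goals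
      filter_upwards [h0] with x hx
      simp only [Prod.fst_zero, Prod.snd_zero, hx, Pi.zero_apply, zero_mul]
  add_mem' := by
    intro a b ha hb φ hφ
    have h1 : ∀ (f g : L2 L) (ψ : ℝ → ℂ), IsTest L ψ →
        ∫ x, (f + g) x * ψ x ∂(vol L) = ∫ x, f x * ψ x ∂(vol L) + ∫ x, g x * ψ x ∂(vol L) := by
      intro f g ψ hψ
      rw [← integral_add (integrable_mul_coe hψ.memLp f) (integrable_mul_coe hψ.memLp g)]
      refine integral_congr_ae ?_
      filter_upwards [Lp.coeFn_add f g] with x hx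
      rw [hx, Pi.add_apply, add_mul]
    change ∫ x, (a.1 + b.1) x * _root_.deriv φ x ∂(vol L) = -∫ x, (a.2 + b.2) x * φ x ∂(vol L)
    rw [h1 _ _ _ hφ.deriv, h1 _ _ _ hφ, ha φ hφ, hb φ hφ]
    ring
  smul_mem' := by
    intro c a ha φ hφ
    have h1 : ∀ (f : L2 L) (ψ : ℝ → ℂ),
        ∫ x, (c • f) x * ψ x ∂(vol L) = c * ∫ x, f x * ψ x ∂(vol L) := by
      intro f ψ
      rw [← integral_const_mul]
      refine integral_congr_ae ?_
      filter_upwards [Lp.coeFn_smul c f] with x hx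
      rw [hx, Pi.smul_apply, smul_eq_mul, mul_assoc]
    change ∫ x, (c • a.1) x * _root_.deriv φ x ∂(vol L) = -∫ x, (c • a.2) x * φ x ∂(vol L)
    rw [h1, h1, ha φ hφ]
    ring

/-- A weak derivative is unique (fundamental lemma of the calculus of variations). -/
lemma weakGraph_unique (z : L2 L × L2 L) (hz : z ∈ weakGraph L) (h0 : z.1 = 0) : z.2 = 0 := by
  have key : ∀ᵐ x ∂volume, x ∈ Ioo 0 L → (z.2 : ℝ → ℂ) x = 0 := by
    refine isOpen_Ioo.ae_eq_zero_of_integral_contDiff_smul_eq_zero ?_ ?_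
    · have : Integrable (z.2 : ℝ → ℂ) (vol L) := (Lp.memLp z.2).integrable (by norm_num)
      exact IntegrableOn.locallyIntegrableOn this
    · intro g hg hgc hgs
      let φ : ℝ → ℂ := fun x => (g x : ℂ)
      have hsupp : tsupport φ ⊆ tsupport g := closure_mono fun x hx => by
        simpa [φ] using hx
      have hφ : IsTest L φ :=
        ⟨Complex.ofRealCLM.contDiff.comp hg,
          hgc.comp_left (g := fun y : ℝ => (y : ℂ)) (by simp), hsupp.trans hgs⟩
      have h := hz φ hφ
      have hz1 : ∫ x, z.1 x * _root_.deriv φ x ∂(vol L) = 0 := by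
        rw [h0]
        refine integral_eq_zero_of_ae ?_
        filter_upwards [Lp.coeFn_zero ℂ 2 (vol L)] with x hx
        rw [hx, Pi.zero_apply, zero_mul]
      rw [hz1, eq_comm, neg_eq_zero] at h
      have h2 : ∫ x, g x • z.2 x ∂(vol L) = 0 := by
        rw [← h]
        refine integral_congr_ae (Filter.Eventually.of_forall fun x => ?_)
        simp [φ, mul_comm]
      rw [← h2]
      refine (setIntegral_eq_integral_of_forall_compl_eq_zero fun x hx => ?_).symm
      have : g x = 0 := by
        by_contra hne
        exact hx (hgs (subset_tsupport g hne))
      simp [this]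
  rw [Lp.eq_zero_iff_ae_eq_zero]
  exact (ae_restrict_iff' measurableSet_Ioo).mpr key

/-- The weak derivative as an unbounded operator on `L²(0, L)`. -/
def weakDeriv (L : ℝ) : L2 L →ₗ.[ℂ] L2 L := (weakGraph L).toLinearPMap

/-- `H¹(0, L)`: the functions in `L²(0, L)` that have a weak derivative in `L²(0, L)`. -/
def H1 (L : ℝ) : Submodule ℂ (L2 L) := (weakDeriv L).domain

/-- The derivative `u ↦ u_x` on `H¹(0, L)`. -/
def dx (L : ℝ) : H1 L →ₗ[ℂ] L2 L := (weakDeriv L).toFun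

lemma dx_spec (u : H1 L) : HasWeakDeriv L (u : L2 L) (dx L u) :=
  Submodule.mem_graph_toLinearPMap (g := weakGraph L) weakGraph_unique u

lemma mem_H1_iff {u : L2 L} : u ∈ H1 L ↔ ∃ g : L2 L, HasWeakDeriv L u g := by
  constructor
  · intro h
    exact ⟨_, dx_spec ⟨u, h⟩⟩
  · rintro ⟨g, hg⟩
    exact ⟨(u, g), hg, rfl⟩

lemma dx_eq {u g : L2 L} (h : HasWeakDeriv L u g) (hu : u ∈ H1 L) : dx L ⟨u, hu⟩ = g := by
  have h1 : ((u, dx L ⟨u, hu⟩) : L2 L × L2 L) ∈ weakGraph L := dx_spec ⟨u, hu⟩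
  have h2 : ((u, g) : L2 L × L2 L) ∈ weakGraph L := h
  have h3 := weakGraph_unique _ ((weakGraph L).sub_mem h1 h2) (by simp)
  exact sub_eq_zero.mp h3

/-- The pairs `(φ, φ')` with `φ` a test function. -/
def testGraph (L : ℝ) : Submodule ℂ (L2 L × L2 L) where
  carrier := {z | ∃ φ : ℝ → ℂ, IsTest L φ ∧ z.1 =ᵐ[vol L] φ ∧ z.2 =ᵐ[vol L] deriv φ}
  zero_mem' := by
    refine ⟨0, ⟨contDiff_const, HasCompactSupport.zero, by simp [tsupport]⟩, ?_, ?_⟩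
    · exact Lp.coeFn_zero _ _ _
    · filter_upwards [Lp.coeFn_zero ℂ 2 (vol L)] with x hx
      rw [Prod.snd_zero, hx]
      simp
  add_mem' := by
    rintro a b ⟨φ, hφ, h1, h2⟩ ⟨ψ, hψ, h3, h4⟩
    refine ⟨φ + ψ, ⟨hφ.smooth.add hψ.smooth, hφ.compact.add hψ.compact,
      (tsupport_add φ ψ).trans (union_subset hφ.supp hψ.supp)⟩, ?_, ?_⟩
    · filter_upwards [Lp.coeFn_add a.1 b.1, h1, h3] with x hx hx1 hx3
      rw [Prod.fst_add, hx, Pi.add_apply, hx1, hx3, Pi.add_apply]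
    · filter_upwards [Lp.coeFn_add a.2 b.2, h2, h4] with x hx hx1 hx3
      rw [deriv_add (hφ.smooth.differentiable (by simp) x) (hψ.smooth.differentiable (by simp) x)]
      rw [Prod.snd_add, hx, Pi.add_apply, hx1, hx3]
  smul_mem' := by
    rintro c a ⟨φ, hφ, h1, h2⟩
    refine ⟨c • φ, ⟨contDiff_const.smul hφ.smooth, hφ.compact.smul_left (f := fun _ => c),
      (closure_mono (Function.support_const_smul_subset c φ)).trans hφ.supp⟩, ?_, ?_⟩
    · filter_upwards [Lp.coeFn_smul c a.1, h1] with x hx hx1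
      rw [Prod.smul_fst, hx, Pi.smul_apply, hx1, Pi.smul_apply]
    · filter_upwards [Lp.coeFn_smul c a.2, h2] with x hx hx1
      rw [deriv_const_smul c (hφ.smooth.differentiable (by simp) x)]
      rw [Prod.smul_snd, hx, Pi.smul_apply, hx1]

/-- `H¹₀(0, L)`: the closure of the test functions in the norm of `H¹(0, L)`, that is, the
functions `u` such that `φₙ → u` and `φₙ' → g` in `L²` for some test functions `φₙ` and
some `g` (which is then `u_x`). -/
def H10 (L : ℝ) : Submodule ℂ (L2 L) :=
  (testGraph L).topologicalClosure.map (LinearMap.fst ℂ (L2 L) (L2 L))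

lemma closure_testGraph_le : (testGraph L).topologicalClosure ≤ weakGraph L := by
  refine Submodule.topologicalClosure_minimal _ ?_ ?_
  · rintro z ⟨φ, hφ, h1, h2⟩ ψ hψ
    have e1 : ∫ x, z.1 x * deriv ψ x ∂(vol L) = ∫ x, φ x * deriv ψ x := by
      rw [← setIntegral_eq_integral_of_forall_compl_eq_zero (μ := volume) (s := Ioo 0 L)
        (f := fun x => φ x * deriv ψ x)]
      · refine integral_congr_ae ?_
        filter_upwards [h1] with x hx
        rw [hx]
      · intro x hx
        rw [image_eq_zero_of_notMem_tsupport fun h => hx (hφ.supp h), zero_mul]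
    have e2 : ∫ x, z.2 x * ψ x ∂(vol L) = ∫ x, deriv φ x * ψ x := by
      rw [← setIntegral_eq_integral_of_forall_compl_eq_zero (μ := volume) (s := Ioo 0 L)
        (f := fun x => deriv φ x * ψ x)]
      · refine integral_congr_ae ?_
        filter_upwards [h2] with x hx
        rw [hx]
      · intro x hx
        rw [image_eq_zero_of_notMem_tsupport fun h => hx (hψ.supp h), mul_zero]
    rw [e1, e2]
    have i1 : Integrable (φ * deriv ψ) :=
      (hφ.smooth.continuous.mul hψ.deriv.smooth.continuous).integrable_of_hasCompactSupport
        hφ.compact.mul_right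
    have i2 : Integrable (deriv φ * ψ) :=
      (hφ.deriv.smooth.continuous.mul hψ.smooth.continuous).integrable_of_hasCompactSupport
        hψ.compact.mul_left
    have i3 : Integrable (φ * ψ) :=
      (hφ.smooth.continuous.mul hψ.smooth.continuous).integrable_of_hasCompactSupport
        hφ.compact.mul_right
    exact integral_mul_deriv_eq_deriv_mul_of_integrable
      (fun x _ => (hφ.smooth.differentiable (by simp) x).hasDerivAt)
      (fun x _ => (hψ.smooth.differentiable (by simp) x).hasDerivAt) i1 i2 i3
  · have : ((weakGraph L : Submodule ℂ (L2 L × L2 L)) : Set (L2 L × L2 L)) =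
        ⋂ (φ : ℝ → ℂ) (_ : IsTest L φ), {z : L2 L × L2 L |
          ∫ x, z.1 x * deriv φ x ∂(vol L) = -∫ x, z.2 x * φ x ∂(vol L)} := by
      ext z
      simp only [mem_iInter]
      exact Iff.rfl
    rw [this]
    refine isClosed_iInter fun φ => isClosed_iInter fun hφ => isClosed_eq ?_ ?_
    · exact (continuous_integral_mul hφ.deriv.memLp).comp continuous_fst
    · exact ((continuous_integral_mul hφ.memLp).comp continuous_snd).neg

lemma H10_le_H1 : H10 L ≤ H1 L := by
  rintro u ⟨z, hz, rfl⟩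
  exact mem_H1_iff.mpr ⟨z.2, closure_testGraph_le hz⟩

/-- The derivative `u ↦ u_x` on `H¹₀(0, L)`. -/
def dx0 (L : ℝ) : H10 L →ₗ[ℂ] L2 L := dx L ∘ₗ Submodule.inclusion H10_le_H1

lemma dx0_mem (u : H10 L) : ((u : L2 L), dx0 L u) ∈ (testGraph L).topologicalClosure := by
  obtain ⟨u, z, hz, rfl⟩ := u
  have : dx0 L ⟨_, z, hz, rfl⟩ = z.2 := dx_eq (closure_testGraph_le hz) _
  rw [this]
  exact hz

lemma vol_univ : vol L univ = ENNReal.ofReal L := by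
  simp

lemma integral_norm_le (hL : 0 ≤ L) (g : L2 L) :
    ∫ x, ‖g x‖ ∂(vol L) ≤ L ^ (2⁻¹ : ℝ) * ‖g‖ := by
  have hg := Lp.memLp g
  have h1 := eLpNorm_le_eLpNorm_mul_rpow_measure_univ (p := 1) (q := 2) (μ := vol L)
    (by norm_num) hg.1
  have hfin : eLpNorm g 2 (vol L) * (vol L univ) ^ (1 / (1 : ℝ≥0∞).toReal - 1 / (2 : ℝ≥0∞).toReal)
      ≠ ⊤ := ENNReal.mul_ne_top hg.2.ne
        (ENNReal.rpow_ne_top_of_nonneg (by norm_num) (measure_ne_top _ _))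
  have h2 := ENNReal.toReal_mono hfin h1
  rw [eLpNorm_one_eq_lintegral_enorm, ← integral_norm_eq_lintegral_enorm hg.1,
    ENNReal.toReal_mul, ← ENNReal.toReal_rpow, vol_univ, ENNReal.toReal_ofReal hL,
    ← Lp.norm_def] at h2
  refine h2.trans (le_of_eq ?_)
  rw [mul_comm]
  norm_num

lemma IsTest.norm_le {φ : ℝ → ℂ} (h : IsTest L φ) {g : L2 L} (hg : g =ᵐ[vol L] _root_.deriv φ)
    (hL : 0 ≤ L) {x : ℝ} (hx : x ∈ Ioo 0 L) : ‖φ x‖ ≤ L ^ (2⁻¹ : ℝ) * ‖g‖ := by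
  refine le_trans ?_ (integral_norm_le hL g)
  have h0 : φ 0 = 0 := image_eq_zero_of_notMem_tsupport fun h' => absurd (h.supp h').1 (lt_irrefl _)
  have hd : φ x = ∫ y in (0 : ℝ)..x, _root_.deriv φ y := by
    rw [intervalIntegral.integral_deriv_eq_sub
      (fun y _ => h.smooth.differentiable (by simp) y)
      (h.deriv.smooth.continuous.intervalIntegrable _ _), h0, sub_zero]
  have hi : Integrable (fun y => ‖_root_.deriv φ y‖) (vol L) :=
    (h.deriv.memLp.integrable (by norm_num)).norm
  rw [hd]
  calc ‖∫ y in (0 : ℝ)..x, _root_.deriv φ y‖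
      ≤ ∫ y in (0 : ℝ)..x, ‖_root_.deriv φ y‖ :=
        intervalIntegral.norm_integral_le_integral_norm hx.1.le
    _ = ∫ y in Ioo 0 x, ‖_root_.deriv φ y‖ := by
        rw [intervalIntegral.integral_of_le hx.1.le, integral_Ioc_eq_integral_Ioo]
    _ ≤ ∫ y, ‖_root_.deriv φ y‖ ∂(vol L) :=
        setIntegral_mono_set hi (Filter.Eventually.of_forall fun _ => norm_nonneg _)
          (Ioo_subset_Ioo_right hx.2.le).eventuallyLE
    _ = ∫ y, ‖g y‖ ∂(vol L) := by
        refine integral_congr_ae ?_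
        filter_upwards [hg] with y hy
        rw [hy]

lemma poincare_test (hL : 0 ≤ L) (z : L2 L × L2 L) (hz : z ∈ testGraph L) :
    ‖z.1‖ ≤ L * ‖z.2‖ := by
  obtain ⟨φ, hφ, h1, h2⟩ := hz
  have hb : ∀ᵐ x ∂(vol L), ‖z.1 x‖ ≤ L ^ (2⁻¹ : ℝ) * ‖z.2‖ := by
    filter_upwards [h1, ae_restrict_mem measurableSet_Ioo] with x hx hxm
    rw [hx]
    exact hφ.norm_le h2 hL hxm
  have h3 := Lp.norm_le_of_ae_bound (by positivity) hb
  have h4 : ((measureUnivNNReal (vol L) : ℝ≥0) : ℝ) = L := by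
    rw [← ENNReal.coe_toReal, coe_measureUnivNNReal, vol_univ, ENNReal.toReal_ofReal hL]
  have h5 : L ^ ((2 : ℝ≥0∞).toReal⁻¹) * L ^ (2⁻¹ : ℝ) = L := by
    rw [ENNReal.toReal_ofNat, ← Real.rpow_add_of_nonneg hL (by norm_num) (by norm_num)]
    norm_num
  rw [h4, ← mul_assoc, h5] at h3
  exact h3

/-- Poincaré's inequality on `H¹₀(0, L)`. -/
lemma poincare (hL : 0 ≤ L) (u : H10 L) : ‖(u : L2 L)‖ ≤ L * ‖dx0 L u‖ := by
  have h : closure (testGraph L : Set (L2 L × L2 L)) ⊆ {z | ‖z.1‖ ≤ L * ‖z.2‖} :=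
    closure_minimal (fun z hz => by
      rw [mem_ofPred_eq]
      exact poincare_test hL z hz)
      (isClosed_le continuous_fst.norm (continuous_const.mul continuous_snd.norm))
  have h2 : ((u : L2 L), dx0 L u) ∈ closure (testGraph L : Set (L2 L × L2 L)) := dx0_mem u
  have h3 := h h2
  rwa [mem_ofPred_eq] at h3

end Sobolev

/-! ### The weighted phase space -/

section Weights

variable {L : ℝ}

lemma memLp_mul {a : ℝ → ℝ} (ha : ContinuousOn a (Icc 0 L)) (f : L2 L) :
    MemLp (fun x => (a x : ℂ) * f x) 2 (vol L) := by
  obtain ⟨C, hC⟩ := isCompact_Icc.exists_bound_of_continuousOn ha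
  have hm : AEStronglyMeasurable a (vol L) :=
    (ha.mono Ioo_subset_Icc_self).aestronglyMeasurable measurableSet_Ioo
  refine (Lp.memLp f).of_le_mul (c := C)
    ((Complex.continuous_ofReal.comp_aestronglyMeasurable hm).mul (Lp.memLp f).1) ?_
  filter_upwards [ae_restrict_mem measurableSet_Ioo] with x hx
  rw [norm_mul, Complex.norm_real]
  exact mul_le_mul_of_nonneg_right (hC x (Ioo_subset_Icc_self hx)) (norm_nonneg _)

/-- Multiplication by the continuous function `a` on `L²(0, L)`. -/
def mulL2 (a : ℝ → ℝ) (ha : ContinuousOn a (Icc 0 L)) : L2 L →ₗ[ℂ] L2 L where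
  toFun f := (memLp_mul ha f).toLp _
  map_add' f g := by
    rw [← MemLp.toLp_add, MemLp.toLp_eq_toLp_iff]
    filter_upwards [Lp.coeFn_add f g] with x hx
    simp only [Pi.add_apply, hx, mul_add]
  map_smul' c f := by
    rw [RingHom.id_apply, ← MemLp.toLp_const_smul, MemLp.toLp_eq_toLp_iff]
    filter_upwards [Lp.coeFn_smul c f] with x hx
    simp only [Pi.smul_apply, hx, smul_eq_mul, mul_left_comm]

/-- The weighted form `∫₀ᴸ a f ḡ dx`. -/
def wform (a : ℝ → ℝ) (f g : L2 L) : ℂ := ∫ x, (a x : ℂ) * f x * conj (g x) ∂(vol L)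

lemma wform_eq_inner {a : ℝ → ℝ} (ha : ContinuousOn a (Icc 0 L)) (f g : L2 L) :
    wform a f g = inner ℂ g (mulL2 a ha f) := by
  rw [L2.inner_def, wform]
  refine integral_congr_ae ?_
  filter_upwards [(memLp_mul ha f).coeFn_toLp] with x hx
  rw [RCLike.inner_apply]
  erw [hx]

lemma wform_conj (a : ℝ → ℝ) (f g : L2 L) : conj (wform a f g) = wform a g f := by
  rw [wform, wform, ← integral_conj]
  refine integral_congr_ae (Filter.Eventually.of_forall fun x => ?_)
  simp
  ring

lemma wform_self (a : ℝ → ℝ) (f : L2 L) :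
    wform a f f = ((∫ x, a x * ‖f x‖ ^ 2 ∂(vol L) : ℝ) : ℂ) := by
  rw [wform, ← integral_complex_ofReal]
  refine integral_congr_ae (Filter.Eventually.of_forall fun x => ?_)
  simp [mul_assoc, Complex.mul_conj, Complex.normSq_eq_norm_sq]

lemma integral_norm_sq (f : L2 L) : ∫ x, ‖f x‖ ^ 2 ∂(vol L) = ‖f‖ ^ 2 := by
  have h : inner ℂ f f = ((∫ x, ‖f x‖ ^ 2 ∂(vol L) : ℝ) : ℂ) := by
    rw [L2.inner_def, ← integral_complex_ofReal]
    refine integral_congr_ae (Filter.Eventually.of_forall fun x => ?_)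
    simp [inner_self_eq_norm_sq_to_K]
  rw [inner_self_eq_norm_sq_to_K] at h
  exact Complex.ofReal_injective (by rw [← h]; simp)

lemma integrable_weight {a : ℝ → ℝ} (ha : ContinuousOn a (Icc 0 L)) (f : L2 L) :
    Integrable (fun x => a x * ‖f x‖ ^ 2) (vol L) := by
  refine ((Lp.memLp f).norm.integrable_mul (memLp_mul ha f).norm).congr ?_ |>.mono'
    (g := fun x => |a x| * ‖f x‖ ^ 2) ?_ ?_
  · refine Filter.Eventually.of_forall fun x => ?_
    simp
    ring
  · exact ((ha.mono Ioo_subset_Icc_self).aestronglyMeasurable measurableSet_Ioo).mul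
      ((Lp.memLp f).1.norm.pow 2)
  · refine Filter.Eventually.of_forall fun x => ?_
    simp

lemma wform_bounds {a : ℝ → ℝ} (hL : 0 < L) (ha : ContinuousOn a (Icc 0 L))
    (hpos : ∀ x ∈ Icc 0 L, 0 < a x) : ∃ c C : ℝ, 0 < c ∧ 0 < C ∧ ∀ f : L2 L,
      c * ‖f‖ ^ 2 ≤ (wform a f f).re ∧ (wform a f f).re ≤ C * ‖f‖ ^ 2 := by
  have hne : (Icc (0 : ℝ) L).Nonempty := nonempty_Icc.mpr hL.le
  obtain ⟨x₀, hx₀, h₀⟩ := isCompact_Icc.exists_isMinOn hne ha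
  obtain ⟨x₁, hx₁, h₁⟩ := isCompact_Icc.exists_isMaxOn hne ha
  have hone : ∀ f : L2 L, Integrable (fun x => ‖f x‖ ^ 2) (vol L) := fun f => by
    simpa using integrable_weight (a := fun _ => 1) continuousOn_const f
  refine ⟨a x₀, a x₁, hpos _ hx₀, hpos _ hx₁, fun f => ?_⟩
  rw [wform_self, Complex.ofReal_re, ← integral_norm_sq, ← integral_const_mul,
    ← integral_const_mul]
  constructor
  · refine integral_mono_ae ((hone f).const_mul _) (integrable_weight ha f) ?_
    filter_upwards [ae_restrict_mem measurableSet_Ioo] with x hx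
    exact mul_le_mul_of_nonneg_right (h₀ (Ioo_subset_Icc_self hx)) (by positivity)
  · refine integral_mono_ae (integrable_weight ha f) ((hone f).const_mul _) ?_
    filter_upwards [ae_restrict_mem measurableSet_Ioo] with x hx
    exact mul_le_mul_of_nonneg_right (h₁ (Ioo_subset_Icc_self hx)) (by positivity)

end Weights

/-- The physical data: the length, the positive constants, and the positive coefficients
`m, δ, p ∈ W^{1,∞}(0, L)`, given by their continuous representatives on `[0, L]`. -/
structure Beam where
  L : ℝ
  τ : ℝ
  η : ℝ
  κ : ℝ
  β : ℝ
  m : ℝ → ℝ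
  δ : ℝ → ℝ
  p : ℝ → ℝ
  L_pos : 0 < L
  τ_pos : 0 < τ
  η_pos : 0 < η
  κ_pos : 0 < κ
  β_pos : 0 < β
  m_mem : MemW1Inf L m
  δ_mem : MemW1Inf L δ
  p_mem : MemW1Inf L p
  m_cont : ContinuousOn m (Icc 0 L)
  δ_cont : ContinuousOn δ (Icc 0 L)
  p_cont : ContinuousOn p (Icc 0 L)
  m_pos : ∀ x ∈ Icc 0 L, 0 < m x
  δ_pos : ∀ x ∈ Icc 0 L, 0 < δ x
  p_pos : ∀ x ∈ Icc 0 L, 0 < p x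

/-- The phase space `H¹₀(0, L) × L²(0, L) × L²(0, L) × L²(0, L)`. -/
def PhaseSpace (B : Beam) : Type := H10 B.L × L2 B.L × L2 B.L × L2 B.L

namespace PhaseSpace

variable {B : Beam}

instance : AddCommGroup (PhaseSpace B) :=
  inferInstanceAs (AddCommGroup (H10 B.L × L2 B.L × L2 B.L × L2 B.L))

instance : Module ℂ (PhaseSpace B) :=
  inferInstanceAs (Module ℂ (H10 B.L × L2 B.L × L2 B.L × L2 B.L))

/-- The element `(u, w, θ, q)` of the phase space. -/
def mk (u : H10 B.L) (w θ q : L2 B.L) : PhaseSpace B := (u, w, θ, q)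

/-- The component `u` of `U = (u, w, θ, q)`; `w`, `θ` and `q` below are the others. -/
def u : PhaseSpace B →ₗ[ℂ] H10 B.L where
  toFun U := U.1
  map_add' _ _ := rfl
  map_smul' _ _ := rfl

def w : PhaseSpace B →ₗ[ℂ] L2 B.L where
  toFun U := U.2.1
  map_add' _ _ := rfl
  map_smul' _ _ := rfl

def θ : PhaseSpace B →ₗ[ℂ] L2 B.L where
  toFun U := U.2.2.1
  map_add' _ _ := rfl
  map_smul' _ _ := rfl

def q : PhaseSpace B →ₗ[ℂ] L2 B.L where
  toFun U := U.2.2.2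
  map_add' _ _ := rfl
  map_smul' _ _ := rfl

@[simp] lemma u_mk (v : H10 B.L) (w' θ' q' : L2 B.L) : u (mk v w' θ' q') = v := rfl

@[simp] lemma w_mk (v : H10 B.L) (w' θ' q' : L2 B.L) : w (mk v w' θ' q') = w' := rfl

@[simp] lemma θ_mk (v : H10 B.L) (w' θ' q' : L2 B.L) : θ (mk v w' θ' q') = θ' := rfl

@[simp] lemma q_mk (v : H10 B.L) (w' θ' q' : L2 B.L) : q (mk v w' θ' q') = q' := rfl

lemma ext' {U V : PhaseSpace B} (h1 : u U = u V) (h2 : w U = w V) (h3 : θ U = θ V)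
    (h4 : q U = q V) : U = V :=
  Prod.ext h1 (Prod.ext h2 (Prod.ext h3 h4))

/-- The weighted inner product, linear in `U` and conjugate linear in `V`:
`∫ p u_x v̄_x + ∫ m w w̄' + ∫ θ θ̄' + τ ∫ q q̄'`. -/
def form (U V : PhaseSpace B) : ℂ :=
  wform B.p (dx0 B.L (u U)) (dx0 B.L (u V)) + wform B.m (w U) (w V)
    + wform (fun _ => 1) (θ U) (θ V) + B.τ * wform (fun _ => 1) (q U) (q V)

lemma form_bounds (B : Beam) : ∃ c C : ℝ, 0 < c ∧ 0 < C ∧ ∀ U : PhaseSpace B,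
    c * (‖dx0 B.L (u U)‖ ^ 2 + ‖w U‖ ^ 2 + ‖θ U‖ ^ 2 + ‖q U‖ ^ 2) ≤ (form U U).re ∧
    (form U U).re ≤ C * (‖dx0 B.L (u U)‖ ^ 2 + ‖w U‖ ^ 2 + ‖θ U‖ ^ 2 + ‖q U‖ ^ 2) := by
  obtain ⟨c1, C1, hc1, hC1, h1⟩ := wform_bounds B.L_pos B.p_cont B.p_pos
  obtain ⟨c2, C2, hc2, hC2, h2⟩ := wform_bounds B.L_pos B.m_cont B.m_pos
  have h3 : ∀ f : L2 B.L, (wform (fun _ => 1) f f).re = ‖f‖ ^ 2 := fun f => by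
    rw [wform_self, Complex.ofReal_re, ← integral_norm_sq]
    simp
  refine ⟨min (min c1 c2) (min 1 B.τ), max (max C1 C2) (max 1 B.τ), ?_, ?_, fun U => ?_⟩
  · exact lt_min (lt_min hc1 hc2) (lt_min one_pos B.τ_pos)
  · exact lt_max_of_lt_left (lt_max_of_lt_left hC1)
  have e : (form U U).re = (wform B.p (dx0 B.L (u U)) (dx0 B.L (u U))).re
      + (wform B.m (w U) (w U)).re + ‖θ U‖ ^ 2 + B.τ * ‖q U‖ ^ 2 := by
    rw [form, Complex.add_re, Complex.add_re, Complex.add_re, Complex.re_ofReal_mul, h3, h3]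
  rw [e]
  have hp := h1 (dx0 B.L (u U))
  have hm := h2 (w U)
  have n1 := sq_nonneg ‖dx0 B.L (u U)‖
  have n2 := sq_nonneg ‖w U‖
  have n3 := sq_nonneg ‖θ U‖
  have n4 := sq_nonneg ‖q U‖
  constructor
  · have a1 : min (min c1 c2) (min 1 B.τ) ≤ c1 := (min_le_left _ _).trans (min_le_left _ _)
    have a2 : min (min c1 c2) (min 1 B.τ) ≤ c2 := (min_le_left _ _).trans (min_le_right _ _)
    have a3 : min (min c1 c2) (min 1 B.τ) ≤ 1 := (min_le_right _ _).trans (min_le_left _ _)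
    have a4 : min (min c1 c2) (min 1 B.τ) ≤ B.τ := (min_le_right _ _).trans (min_le_right _ _)
    linarith [mul_le_mul_of_nonneg_right a1 n1, mul_le_mul_of_nonneg_right a2 n2,
      mul_le_mul_of_nonneg_right a3 n3, mul_le_mul_of_nonneg_right a4 n4, hp.1, hm.1]
  · have a1 : C1 ≤ max (max C1 C2) (max 1 B.τ) := (le_max_left _ _).trans (le_max_left _ _)
    have a2 : C2 ≤ max (max C1 C2) (max 1 B.τ) := (le_max_right _ _).trans (le_max_left _ _)
    have a3 : 1 ≤ max (max C1 C2) (max 1 B.τ) := (le_max_left _ _).trans (le_max_right _ _)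
    have a4 : B.τ ≤ max (max C1 C2) (max 1 B.τ) := (le_max_right _ _).trans (le_max_right _ _)
    linarith [mul_le_mul_of_nonneg_right a1 n1, mul_le_mul_of_nonneg_right a2 n2,
      mul_le_mul_of_nonneg_right a3 n3, mul_le_mul_of_nonneg_right a4 n4, hp.2, hm.2]

/-- `⟪U, V⟫ = form V U`, because Mathlib's inner products are conjugate linear in the first
argument. -/
@[reducible]
def core (B : Beam) : InnerProductSpace.Core ℂ (PhaseSpace B) where
  inner U V := form V U
  conj_inner_symm U V := by
    simp only [form, map_add, map_mul, wform_conj, Complex.conj_ofReal]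
  re_inner_nonneg U := by
    obtain ⟨c, C, hc, hC, h⟩ := form_bounds B
    exact le_trans (by positivity) (h U).1
  add_left U V W := by
    simp only [form, map_add, wform_eq_inner B.p_cont, wform_eq_inner B.m_cont,
      wform_eq_inner (a := fun _ => 1) continuousOn_const, inner_add_left]
    ring
  smul_left U V r := by
    simp only [form, map_smul, wform_eq_inner B.p_cont, wform_eq_inner B.m_cont,
      wform_eq_inner (a := fun _ => 1) continuousOn_const, inner_smul_left]
    ring
  definite U hU := by
    obtain ⟨c, C, hc, hC, h⟩ := form_bounds B
    have h1 := (h U).1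
    have h2 : (form U U).re = 0 := by
      rw [show form U U = 0 from hU, Complex.zero_re]
    rw [h2] at h1
    have n1 := sq_nonneg ‖dx0 B.L (u U)‖
    have n2 := sq_nonneg ‖w U‖
    have n3 := sq_nonneg ‖θ U‖
    have n4 := sq_nonneg ‖q U‖
    have h3 := nonpos_of_mul_nonpos_right h1 hc
    have z1 : ‖dx0 B.L (u U)‖ = 0 := pow_eq_zero_iff (two_ne_zero) |>.mp (by linarith)
    have z2 : ‖w U‖ = 0 := pow_eq_zero_iff (two_ne_zero) |>.mp (by linarith)
    have z3 : ‖θ U‖ = 0 := pow_eq_zero_iff (two_ne_zero) |>.mp (by linarith)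
    have z4 : ‖q U‖ = 0 := pow_eq_zero_iff (two_ne_zero) |>.mp (by linarith)
    have hu := poincare B.L_pos.le (u U)
    rw [z1, mul_zero] at hu
    have hu' : u U = 0 := Subtype.ext (norm_le_zero_iff.mp hu)
    refine ext' ?_ ?_ ?_ ?_
    · rw [hu', map_zero]
    · rw [norm_eq_zero.mp z2, map_zero]
    · rw [norm_eq_zero.mp z3, map_zero]
    · rw [norm_eq_zero.mp z4, map_zero]

instance : NormedAddCommGroup (PhaseSpace B) := (core B).toNormedAddCommGroup

instance : InnerProductSpace ℂ (PhaseSpace B) := InnerProductSpace.ofCore (core B).toCore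

lemma inner_eq (U V : PhaseSpace B) : inner ℂ U V = form V U := rfl

lemma norm_sq_eq (U : PhaseSpace B) : ‖U‖ ^ 2 = (form U U).re := by
  rw [← inner_eq, ← inner_self_eq_norm_sq (𝕜 := ℂ)]
  rfl

instance : CompleteSpace (PhaseSpace B) := by
  obtain ⟨c, C, hc, hC, h⟩ := form_bounds B
  have hcs : ∀ (f : PhaseSpace B →ₗ[ℂ] L2 B.L), (∀ U, c * ‖f U‖ ^ 2 ≤ ‖U‖ ^ 2) →
      ∀ V : ℕ → PhaseSpace B, CauchySeq V → CauchySeq fun n => f (V n) := by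
    intro f hf V hV
    have hb : ∀ U, ‖f U‖ ≤ (Real.sqrt c)⁻¹ * ‖U‖ := fun U => by
      rw [inv_mul_eq_div, le_div_iff₀ (Real.sqrt_pos.mpr hc)]
      refine abs_le_of_sq_le_sq' ?_ (norm_nonneg U) |>.2
      rw [mul_pow, Real.sq_sqrt hc.le, mul_comm]
      exact hf U
    exact (f.mkContinuous _ hb).uniformContinuous.comp_cauchySeq hV
  have hlow : ∀ U : PhaseSpace B, c * ‖dx0 B.L (u U)‖ ^ 2 + c * ‖w U‖ ^ 2 + c * ‖θ U‖ ^ 2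
      + c * ‖q U‖ ^ 2 ≤ ‖U‖ ^ 2 := fun U => by
    rw [norm_sq_eq]
    linarith [(h U).1]
  have hn : ∀ x : ℝ, 0 ≤ c * x ^ 2 := fun x => by positivity
  refine Metric.complete_of_cauchySeq_tendsto fun V hV => ?_
  have c1 := hcs (dx0 B.L ∘ₗ u) (fun U => by
    have := hlow U
    simp only [LinearMap.comp_apply]
    linarith [hn ‖w U‖, hn ‖θ U‖, hn ‖q U‖]) V hV
  have c2 := hcs w (fun U => by
    linarith [hlow U, hn ‖dx0 B.L (u U)‖, hn ‖θ U‖, hn ‖q U‖]) V hV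
  have c3 := hcs θ (fun U => by
    linarith [hlow U, hn ‖dx0 B.L (u U)‖, hn ‖w U‖, hn ‖q U‖]) V hV
  have c4 := hcs q (fun U => by
    linarith [hlow U, hn ‖dx0 B.L (u U)‖, hn ‖w U‖, hn ‖θ U‖]) V hV
  have c0 : CauchySeq fun n => ((u (V n) : H10 B.L) : L2 B.L) := by
    rw [Metric.cauchySeq_iff'] at c1 ⊢
    intro ε hε
    obtain ⟨N, hN⟩ := c1 (ε / B.L) (div_pos hε B.L_pos)
    refine ⟨N, fun n hn => ?_⟩
    have h1 := poincare B.L_pos.le (u (V n) - u (V N))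
    have h2 := hN n hn
    rw [dist_eq_norm, lt_div_iff₀ B.L_pos] at h2
    simp only [LinearMap.comp_apply] at h2
    rw [map_sub] at h1
    rw [dist_eq_norm, ← Submodule.coe_sub]
    linarith
  obtain ⟨l0, h0⟩ := cauchySeq_tendsto_of_complete c0
  obtain ⟨l1, h1⟩ := cauchySeq_tendsto_of_complete c1
  obtain ⟨l2, h2⟩ := cauchySeq_tendsto_of_complete c2
  obtain ⟨l3, h3⟩ := cauchySeq_tendsto_of_complete c3
  obtain ⟨l4, h4⟩ := cauchySeq_tendsto_of_complete c4
  have hmem : ((l0, l1) : L2 B.L × L2 B.L) ∈ (testGraph B.L).topologicalClosure :=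
    (testGraph B.L).isClosed_topologicalClosure.mem_of_tendsto (h0.prodMk_nhds h1)
      (Filter.Eventually.of_forall fun n => dx0_mem (u (V n)))
  have hl0 : l0 ∈ H10 B.L := ⟨(l0, l1), hmem, rfl⟩
  have hdx : dx0 B.L ⟨l0, hl0⟩ = l1 := dx_eq (closure_testGraph_le hmem) (H10_le_H1 hl0)
  refine ⟨mk ⟨l0, hl0⟩ l2 l3 l4, ?_⟩
  have g : Filter.Tendsto (fun n => C * (‖dx0 B.L (u (V n)) - l1‖ ^ 2 + ‖w (V n) - l2‖ ^ 2
      + ‖θ (V n) - l3‖ ^ 2 + ‖q (V n) - l4‖ ^ 2)) Filter.atTop (nhds 0) := by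
    have e1 := (tendsto_iff_norm_sub_tendsto_zero.mp h1).pow 2
    have e2 := (tendsto_iff_norm_sub_tendsto_zero.mp h2).pow 2
    have e3 := (tendsto_iff_norm_sub_tendsto_zero.mp h3).pow 2
    have e4 := (tendsto_iff_norm_sub_tendsto_zero.mp h4).pow 2
    simpa using (((e1.add e2).add e3).add e4).const_mul C
  rw [tendsto_iff_norm_sub_tendsto_zero]
  have g2 : Filter.Tendsto (fun n => ‖V n - mk ⟨l0, hl0⟩ l2 l3 l4‖ ^ 2) Filter.atTop
      (nhds 0) := by
    refine squeeze_zero (fun n => by positivity) (fun n => ?_) g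
    have := (h (V n - mk ⟨l0, hl0⟩ l2 l3 l4)).2
    rw [← norm_sq_eq] at this
    simpa only [map_sub, u_mk, w_mk, θ_mk, q_mk, hdx] using this
  have g3 := g2.sqrt
  simpa using g3

end PhaseSpace

/-! ### The operators -/

/-- The two sets of boundary conditions (besides `u = 0`): `θ = 0`, or `q = 0`, at both ends. -/
inductive Boundary
  | temperature
  | flux

/-- The space prescribed for `θ`. -/
def Boundary.θSpace (L : ℝ) : Boundary → Submodule ℂ (L2 L)
  | temperature => H10 L
  | flux => H1 L

/-- The space prescribed for `q`. -/
def Boundary.qSpace (L : ℝ) : Boundary → Submodule ℂ (L2 L)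
  | temperature => H1 L
  | flux => H10 L

lemma Boundary.θSpace_le (L : ℝ) (bc : Boundary) : bc.θSpace L ≤ H1 L := by
  cases bc
  · exact H10_le_H1
  · exact le_rfl

lemma Boundary.qSpace_le (L : ℝ) (bc : Boundary) : bc.qSpace L ≤ H1 L := by
  cases bc
  · exact le_rfl
  · exact H10_le_H1

section Operator

open PhaseSpace

variable (B : Beam) (bc : Boundary)

/-- `p u_x + 2 δ w_x`. -/
def stress (v w : H10 B.L) : L2 B.L :=
  mulL2 B.p B.p_cont (dx0 B.L v) + (2 : ℂ) • mulL2 B.δ B.δ_cont (dx0 B.L w)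

lemma stress_add (v v' w w' : H10 B.L) :
    stress B (v + v') (w + w') = stress B v w + stress B v' w' := by
  simp only [stress, map_add, smul_add]
  abel

lemma stress_smul (c : ℂ) (v w : H10 B.L) : stress B (c • v) (c • w) = c • stress B v w := by
  simp only [stress, map_smul, smul_add, smul_comm c]

/-- The domain `𝒟₁` (for `Boundary.temperature`) or `𝒟₂` (for `Boundary.flux`). -/
def opDomain : Submodule ℂ (PhaseSpace B) where
  carrier := {U | (∃ hw : w U ∈ H10 B.L, stress B (u U) ⟨w U, hw⟩ ∈ H1 B.L) ∧
    θ U ∈ bc.θSpace B.L ∧ q U ∈ bc.qSpace B.L}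
  zero_mem' := by
    refine ⟨⟨by simp, ?_⟩, by simp, by simp⟩
    have h := stress_smul B 0 0 0
    rw [zero_smul, zero_smul] at h
    change stress B 0 0 ∈ H1 B.L
    rw [h]
    exact zero_mem _
  add_mem' := by
    rintro U V ⟨⟨hw, hs⟩, hθ, hq⟩ ⟨⟨hw', hs'⟩, hθ', hq'⟩
    refine ⟨⟨by simpa using add_mem hw hw', ?_⟩, by simpa using add_mem hθ hθ',
      by simpa using add_mem hq hq'⟩
    have := add_mem hs hs'
    rw [← stress_add] at this
    simpa using this
  smul_mem' := by
    rintro c U ⟨⟨hw, hs⟩, hθ, hq⟩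
    refine ⟨⟨by simpa using Submodule.smul_mem _ c hw, ?_⟩,
      by simpa using Submodule.smul_mem _ c hθ, by simpa using Submodule.smul_mem _ c hq⟩
    have := Submodule.smul_mem _ c hs
    rw [← stress_smul] at this
    simpa using this

variable {B bc}

/-- The component `w` of an element of the domain, as an element of `H¹₀`. -/
def w0 : opDomain B bc →ₗ[ℂ] H10 B.L where
  toFun U := ⟨w (U : PhaseSpace B), U.2.1.1⟩
  map_add' _ _ := rfl
  map_smul' _ _ := rfl

/-- The component `θ` of an element of the domain, as an element of `H¹`. -/
def θ1 : opDomain B bc →ₗ[ℂ] H1 B.L where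
  toFun U := ⟨θ (U : PhaseSpace B), bc.θSpace_le _ U.2.2.1⟩
  map_add' _ _ := rfl
  map_smul' _ _ := rfl

/-- The component `q` of an element of the domain, as an element of `H¹`. -/
def q1 : opDomain B bc →ₗ[ℂ] H1 B.L where
  toFun U := ⟨q (U : PhaseSpace B), bc.qSpace_le _ U.2.2.2⟩
  map_add' _ _ := rfl
  map_smul' _ _ := rfl

/-- `p u_x + 2 δ w_x` for an element of the domain, as an element of `H¹`. -/
def stress1 : opDomain B bc →ₗ[ℂ] H1 B.L where
  toFun U := ⟨stress B (u (U : PhaseSpace B)) (w0 U), U.2.1.2⟩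
  map_add' U V := Subtype.ext (by
    simp [stress_add])
  map_smul' c U := Subtype.ext (by
    simp [stress_smul])

lemma inv_m_cont (B : Beam) : ContinuousOn (fun x => 1 / B.m x) (Icc 0 B.L) :=
  continuousOn_const.div B.m_cont fun x hx => (B.m_pos x hx).ne'

/-- `A U = (w, m⁻¹ (p u_x + 2 δ w_x - η θ)_x, -κ q_x - η w_x, -τ⁻¹ (κ θ_x + β q))`. -/
def opFun (U : opDomain B bc) : PhaseSpace B :=
  mk (w0 U)
    (mulL2 (fun x => 1 / B.m x) (inv_m_cont B) (dx B.L (stress1 U - (B.η : ℂ) • θ1 U)))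
    (-((B.κ : ℂ) • dx B.L (q1 U)) - (B.η : ℂ) • dx0 B.L (w0 U))
    ((-1 / B.τ : ℂ) • ((B.κ : ℂ) • dx B.L (θ1 U) + (B.β : ℂ) • q (U : PhaseSpace B)))

variable (B bc)

/-- The operator `𝒜` with domain `𝒟₁` or `𝒟₂`, as an unbounded operator on the phase space. -/
def op : PhaseSpace B →ₗ.[ℂ] PhaseSpace B where
  domain := opDomain B bc
  toFun :=
    { toFun := opFun
      map_add' := fun U V => by
        refine ext' ?_ ?_ ?_ ?_
        · simp only [map_add, opFun, u_mk]
        · simp only [map_add, map_sub, map_smul, opFun, w_mk]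
          module
        · simp only [map_add, opFun, θ_mk]
          module
        · simp only [map_add, opFun, q_mk, Submodule.coe_add]
          module
      map_smul' := fun c U => by
        refine ext' ?_ ?_ ?_ ?_
        · simp only [map_smul, opFun, u_mk, RingHom.id_apply]
        · simp only [map_smul, map_sub, opFun, w_mk, RingHom.id_apply]
          module
        · simp only [map_smul, opFun, θ_mk, RingHom.id_apply]
          module
        · simp only [map_smul, opFun, q_mk, Submodule.coe_smul, RingHom.id_apply]
          module }

end Operator

/-! ### Abstract Cauchy problems -/

section Cauchy

variable {E : Type*} [NormedAddCommGroup E] [NormedSpace ℂ E]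

/-- `U ∈ C([0, ∞); E)` is a mild solution of `U' = A U`, `U(0) = U₀`: for all `t ≥ 0`,
`∫₀ᵗ U(s) ds` lies in the domain of `A` and `U(t) = U₀ + A ∫₀ᵗ U(s) ds`. -/
def IsMildSolution (A : E →ₗ.[ℂ] E) (U₀ : E) (U : C(ℝ≥0, E)) : Prop :=
  ∀ t : ℝ≥0, ∃ h : (∫ s in (0 : ℝ)..t, U s.toNNReal) ∈ A.domain, U t = U₀ + A ⟨_, h⟩

/-- `U ∈ C¹([0, ∞); E)`. -/
def IsC1 (U : ℝ≥0 → E) : Prop := ContDiffOn ℝ 1 (fun s : ℝ => U s.toNNReal) (Ici 0)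

/-- `U ∈ C([0, ∞); D(A))`, where `D(A)` carries the graph norm. -/
def IsContInDomain (A : E →ₗ.[ℂ] E) (U : ℝ≥0 → E) : Prop :=
  ∃ h : ∀ t, U t ∈ A.domain, Continuous fun t => ((U t, A ⟨U t, h t⟩) : E × E)

/-- `U(t) ∈ D(A)` and `U'(t) = A U(t)` for all `t ≥ 0` (one-sided derivative at `0`), and
`U(0) = U₀`. -/
def IsStrongSolution (A : E →ₗ.[ℂ] E) (U₀ : E) (U : ℝ≥0 → E) : Prop :=
  U 0 = U₀ ∧ ∀ t : ℝ≥0, ∃ h : U t ∈ A.domain,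
    HasDerivWithinAt (fun s : ℝ => U s.toNNReal) (A ⟨U t, h⟩) (Ici 0) t

end Cauchy

end Cattaneo

end

open MeasureTheory Set
open scoped ContDiff ComplexConjugate NNReal ENNReal

noncomputable section

open Filter Topology

namespace Cattaneo

/-! ### Maximal dissipative operators on Hilbert spaces -/

/-! In the energy inner product the phase space is a Hilbert space, and the theorem is an instance
of the Lumer–Phillips theorem. It splits into two facts: a maximal dissipative operator on a complex
Hilbert space has a well-posed Cauchy problem (`existsUnique_isMildSolution`, `regularity`), and the
thermoelastic operator is maximal dissipative (`isMaximalDissipative_op`).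

For the first fact, `A` is replaced by its bounded Yosida approximations `A (1 - c A)⁻¹`, whose
exponentials are contractions for `t ≥ 0`. Dissipativity makes these exponentials Cauchy as `c → 0`,
with an explicit rate on the domain (`norm_flow_sub_flow_sq_le`), and density of the domain extends
this to every initial value. The limit is a mild solution because `A` is closed. Uniqueness is the
energy estimate `norm_sq_le_of_re_inner_le` applied to the integrated difference. Regularity comes
from integrating the mild solution that starts at `A x`.

For the second fact, dissipativity is an energy identity (`re_inner_op`): all couplings cancel and
only the viscous and thermal damping survive. Surjectivity of `1 - c A` is a Lax–Milgram argument.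
Whichever of `θ`, `q` has no boundary condition is eliminated algebraically, leaving a coercive
system for `w` and the other variable in `H¹₀ × H¹₀` (`exists_weak_solution`). The weak equations
then say that the stress and the eliminated variable have weak derivatives in `L²`, which is the
regularity the domain asks for (`exists_sub_smul_eq_of_weak`). -/

/-- `A` is maximal dissipative: `Re ⟪x, A x⟫ ≤ 0` on the domain, and `1 - c A` maps the domain
onto the whole space for every `c > 0`. -/
structure IsMaximalDissipative {E : Type*} [NormedAddCommGroup E] [InnerProductSpace ℂ E]
    (A : E →ₗ.[ℂ] E) : Prop where
  re_inner_nonpos : ∀ x : A.domain, (inner ℂ (x : E) (A x)).re ≤ 0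
  exists_sub_smul_eq : ∀ c : ℝ, 0 < c → ∀ y : E, ∃ x : A.domain, (x : E) - (c : ℂ) • A x = y

/-! ### Energy estimate for differentiable curves -/

section Energy

variable {E : Type*} [NormedAddCommGroup E] [InnerProductSpace ℂ E]

lemma re_inner_self (x : E) : (inner ℂ x x).re = ‖x‖ ^ 2 :=
  inner_self_eq_norm_sq (𝕜 := ℂ) x

/-- If `Re ⟪f, f'⟫ ≤ K` then `‖f‖²` grows at most like `2 K t`. -/
lemma norm_sq_le_of_re_inner_le {f f' : ℝ → E} {K : ℝ} (hf : ∀ t, HasDerivAt f (f' t) t)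
    (hK : ∀ t, 0 ≤ t → (inner ℂ (f t) (f' t)).re ≤ K) {t : ℝ} (ht : 0 ≤ t) :
    ‖f t‖ ^ 2 ≤ ‖f 0‖ ^ 2 + 2 * K * t := by
  -- The derivative of `‖f‖²` lives over `ℝ`; the restricted inner product is the real part of the
  -- complex one.
  let _ : InnerProductSpace ℝ E := InnerProductSpace.complexToReal
  have hd : ∀ s, HasDerivAt (fun s => ‖f s‖ ^ 2 - 2 * K * s)
      (2 * (inner ℂ (f s) (f' s)).re - 2 * K * 1) s := fun s =>
    (hf s).norm_sq.sub ((hasDerivAt_id s).const_mul (2 * K))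
  have hanti : AntitoneOn (fun s => ‖f s‖ ^ 2 - 2 * K * s) (Ici 0) := by
    refine antitoneOn_of_hasDerivWithinAt_nonpos (convex_Ici 0)
      (fun s _ => (hd s).continuousAt.continuousWithinAt)
      (fun s _ => (hd s).hasDerivWithinAt) fun s hs => ?_
    have := hK s (interior_subset hs)
    linarith
  have := hanti (mem_Ici.mpr le_rfl) (mem_Ici.mpr ht) ht
  simp only [mul_zero, sub_zero] at this
  linarith

end Energy

/-! ### Resolvents, closedness and density of the domain -/

namespace IsMaximalDissipative

variable {E : Type*} [NormedAddCommGroup E] [InnerProductSpace ℂ E]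
variable {A : E →ₗ.[ℂ] E}

/-- Dissipativity gives `‖x‖² ≤ Re ⟪x, x - c A x⟫`, and Cauchy–Schwarz does the rest. This yields
both injectivity of `1 - c A` and the contraction bound for its inverse. -/
lemma norm_le_norm_sub_smul (hA : IsMaximalDissipative A) {c : ℝ} (hc : 0 < c) (x : A.domain) :
    ‖(x : E)‖ ≤ ‖(x : E) - (c : ℂ) • A x‖ := by
  have h1 : ‖(x : E)‖ ^ 2 ≤ (inner ℂ (x : E) ((x : E) - (c : ℂ) • A x)).re := by
    rw [inner_sub_right, inner_smul_right, Complex.sub_re, Complex.re_ofReal_mul,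
      re_inner_self]
    have := mul_nonpos_of_nonneg_of_nonpos hc.le (hA.re_inner_nonpos x)
    linarith
  have h2 := (Complex.re_le_norm _).trans (norm_inner_le_norm (𝕜 := ℂ) (x : E)
    ((x : E) - (c : ℂ) • A x))
  rcases (norm_nonneg (x : E)).eq_or_lt with h0 | h0
  · rw [← h0]
    exact norm_nonneg _
  · exact le_of_mul_le_mul_left (by nlinarith) h0

lemma exists_resolvent (hA : IsMaximalDissipative A)
    {c : ℝ} (hc : 0 < c) : ∃ J : E →L[ℂ] E, (∀ y, ‖J y‖ ≤ ‖y‖) ∧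
    ∀ x y, J y = x ↔ ∃ h : x ∈ A.domain, x - (c : ℂ) • A ⟨x, h⟩ = y := by
  choose g hg using hA.exists_sub_smul_eq c hc
  have huniq : ∀ x x' : A.domain,
      (x : E) - (c : ℂ) • A x = (x' : E) - (c : ℂ) • A x' → x = x' := by
    intro x x' h
    have h1 := hA.norm_le_norm_sub_smul hc (x - x')
    have h2 : ((x - x' : A.domain) : E) - (c : ℂ) • A (x - x') = 0 := by
      rw [A.map_sub, Submodule.coe_sub, smul_sub, ← sub_eq_zero.mpr h]
      abel
    rw [h2, norm_zero] at h1
    exact sub_eq_zero.mp (Subtype.ext (norm_le_zero_iff.mp h1))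
  let J₀ : E →ₗ[ℂ] E :=
    { toFun := fun y => g y
      map_add' := fun y z => by
        rw [← Submodule.coe_add]
        refine congrArg _ (huniq _ _ ?_)
        rw [hg, A.map_add, Submodule.coe_add, smul_add]
        nth_rewrite 1 [← hg y, ← hg z]
        abel
      map_smul' := fun a y => by
        rw [RingHom.id_apply, ← Submodule.coe_smul]
        refine congrArg _ (huniq _ _ ?_)
        rw [hg, A.map_smul, Submodule.coe_smul, smul_comm, ← smul_sub, hg] }
  have hJ : ∀ y, ‖J₀ y‖ ≤ 1 * ‖y‖ := fun y => by
    have := hA.norm_le_norm_sub_smul hc (g y)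
    rw [hg] at this
    rw [one_mul]
    exact this
  refine ⟨J₀.mkContinuous 1 hJ, fun y => by simpa using hJ y, fun x y => ⟨?_, ?_⟩⟩
  · rintro rfl
    exact ⟨(g y).2, hg y⟩
  · rintro ⟨h, rfl⟩
    exact congrArg Subtype.val (huniq (g _) ⟨x, h⟩ (hg _))

/-- The resolvent `(1 - c A)⁻¹`. -/
def resolvent (hA : IsMaximalDissipative A) {c : ℝ} (hc : 0 < c) : E →L[ℂ] E :=
  (hA.exists_resolvent hc).choose

lemma norm_resolvent_le (hA : IsMaximalDissipative A)
    {c : ℝ} (hc : 0 < c) (y : E) : ‖hA.resolvent hc y‖ ≤ ‖y‖ :=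
  (hA.exists_resolvent hc).choose_spec.1 y

lemma resolvent_eq_iff (hA : IsMaximalDissipative A) {c : ℝ} (hc : 0 < c) {x y : E} :
    hA.resolvent hc y = x ↔ ∃ h : x ∈ A.domain, x - (c : ℂ) • A ⟨x, h⟩ = y :=
  (hA.exists_resolvent hc).choose_spec.2 x y

/-- Encodes the graph of the unbounded `A` as an equation for a bounded operator, so that limits and
integrals pass through by continuity and linearity. -/
lemma mem_graph_iff (hA : IsMaximalDissipative A) {x y : E} :
    (∃ h : x ∈ A.domain, A ⟨x, h⟩ = y) ↔ hA.resolvent one_pos (x - y) = x := by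
  rw [resolvent_eq_iff]
  simp

/-- A maximal dissipative operator is closed. -/
lemma mem_graph_of_tendsto (hA : IsMaximalDissipative A)
    {ι : Type*} {l : Filter ι} [l.NeBot] {f g : ι → E} {x y : E}
    (hfg : ∀ i, ∃ h : f i ∈ A.domain, A ⟨f i, h⟩ = g i) (hf : Tendsto f l (𝓝 x))
    (hg : Tendsto g l (𝓝 y)) : ∃ h : x ∈ A.domain, A ⟨x, h⟩ = y := by
  rw [hA.mem_graph_iff]
  refine tendsto_nhds_unique (((hA.resolvent one_pos).continuous.tendsto _).comp (hf.sub hg)) ?_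
  refine hf.congr fun i => ?_
  exact (hA.mem_graph_iff.mp (hfg i)).symm

/-- A maximal dissipative operator commutes with integration. -/
lemma integral_mem_graph (hA : IsMaximalDissipative A)
    [CompleteSpace E] {f g : ℝ → E} (hf : Continuous f) (hg : Continuous g)
    {a b : ℝ} (hab : a ≤ b) (hfg : ∀ s ∈ Icc a b, ∃ h : f s ∈ A.domain, A ⟨f s, h⟩ = g s) :
    ∃ h : (∫ s in a..b, f s) ∈ A.domain, A ⟨_, h⟩ = ∫ s in a..b, g s := by
  rw [hA.mem_graph_iff, ← intervalIntegral.integral_sub (hf.intervalIntegrable _ _)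
    (hg.intervalIntegrable _ _), ← ContinuousLinearMap.intervalIntegral_comp_comm _
    (f := fun s => f s - g s) ((hf.sub hg).intervalIntegrable _ _)]
  refine intervalIntegral.integral_congr fun s hs => ?_
  rw [uIcc_of_le hab] at hs
  exact hA.mem_graph_iff.mp (hfg s hs)

/-- The domain of a maximal dissipative operator on a Hilbert space is dense. -/
lemma dense_domain (hA : IsMaximalDissipative A) [CompleteSpace E] : Dense (A.domain : Set E) := by
  rw [Submodule.dense_iff_topologicalClosure_eq_top, Submodule.topologicalClosure_eq_top_iff,
    Submodule.eq_bot_iff]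
  intro z hz
  -- If `z = x - A x` is orthogonal to the domain, it is orthogonal to `x` itself, so `‖x‖² = Re ⟪x,
  -- A x⟫ ≤ 0`.
  obtain ⟨x, hx⟩ := hA.exists_sub_smul_eq 1 one_pos z
  have h0 : inner ℂ (x : E) z = 0 := hz x x.2
  have h1 := hA.re_inner_nonpos x
  have h2 := congrArg Complex.re h0
  rw [← hx, inner_sub_right, inner_smul_right, Complex.sub_re, Complex.re_ofReal_mul,
    re_inner_self, Complex.zero_re] at h2
  have h3 : ‖(x : E)‖ = 0 := by
    have := sq_nonneg ‖(x : E)‖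
    exact pow_eq_zero_iff two_ne_zero |>.mp (by linarith)
  have h4 : x = 0 := Subtype.ext (norm_eq_zero.mp h3)
  rw [← hx, h4]
  simp

/-! ### Yosida approximations -/

/-- The Yosida approximation `c⁻¹ ((1 - c A)⁻¹ - 1) = A (1 - c A)⁻¹`. -/
def yosida (hA : IsMaximalDissipative A) {c : ℝ} (hc : 0 < c) : E →L[ℂ] E :=
  (c⁻¹ : ℂ) • (hA.resolvent hc - ContinuousLinearMap.id ℂ E)

lemma resolvent_sub_smul_yosida (hA : IsMaximalDissipative A) {c : ℝ} (hc : 0 < c) (x : E) :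
    hA.resolvent hc x - (c : ℂ) • hA.yosida hc x = x := by
  have : (c : ℂ) ≠ 0 := by exact_mod_cast hc.ne'
  simp [yosida, smul_smul, this]

lemma apply_resolvent (hA : IsMaximalDissipative A) {c : ℝ} (hc : 0 < c) (x : E) :
    ∃ h : hA.resolvent hc x ∈ A.domain, A ⟨_, h⟩ = hA.yosida hc x := by
  obtain ⟨h, h'⟩ := (hA.resolvent_eq_iff hc (y := x)).mp rfl
  refine ⟨h, ?_⟩
  have h2 := h'.trans (hA.resolvent_sub_smul_yosida hc x).symm
  have : (c : ℂ) ≠ 0 := by exact_mod_cast hc.ne'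
  exact smul_right_injective E this (sub_right_injective h2)

lemma yosida_of_mem (hA : IsMaximalDissipative A) {c : ℝ} (hc : 0 < c) (x : A.domain) :
    hA.yosida hc x = hA.resolvent hc (A x) := by
  have h : hA.resolvent hc ((x : E) - (c : ℂ) • A x) = x :=
    (hA.resolvent_eq_iff hc).mpr ⟨x.2, rfl⟩
  have : (c : ℂ) ≠ 0 := by exact_mod_cast hc.ne'
  rw [map_sub, map_smul, sub_eq_iff_eq_add] at h
  rw [yosida, smul_apply, sub_apply, h,
    ContinuousLinearMap.id_apply, add_sub_cancel_left, inv_smul_smul₀ this]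

lemma norm_yosida_le (hA : IsMaximalDissipative A)
    {c : ℝ} (hc : 0 < c) (x : A.domain) : ‖hA.yosida hc x‖ ≤ ‖A x‖ := by
  rw [hA.yosida_of_mem hc]
  exact hA.norm_resolvent_le hc _

/-- Yosida values are values of `A` at resolvent points, so this is dissipativity of `A` at the
difference of two such points, even for different parameters. -/
lemma re_inner_resolvent_sub_nonpos (hA : IsMaximalDissipative A)
    {c d : ℝ} (hc : 0 < c) (hd : 0 < d) (x y : E) :
    (inner ℂ (hA.resolvent hc x - hA.resolvent hd y)
      (hA.yosida hc x - hA.yosida hd y)).re ≤ 0 := by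
  obtain ⟨h, e⟩ := hA.apply_resolvent hc x
  obtain ⟨h', e'⟩ := hA.apply_resolvent hd y
  have := hA.re_inner_nonpos (⟨_, h⟩ - ⟨_, h'⟩)
  rwa [A.map_sub, e, e'] at this

/-- Each argument differs from its resolvent point by `c` (or `d`) times its Yosida value. At the
resolvent points the pairing is nonpositive, and the correction costs at most `(c + d) M · 2 M`. -/
lemma re_inner_yosida_sub_le (hA : IsMaximalDissipative A)
    {c d : ℝ} (hc : 0 < c) (hd : 0 < d) (x y : E) {M : ℝ}
    (hx : ‖hA.yosida hc x‖ ≤ M) (hy : ‖hA.yosida hd y‖ ≤ M) :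
    (inner ℂ (x - y) (hA.yosida hc x - hA.yosida hd y)).re ≤ 2 * (c + d) * M ^ 2 := by
  have e : x - y = (hA.resolvent hc x - hA.resolvent hd y)
      - ((c : ℂ) • hA.yosida hc x - (d : ℂ) • hA.yosida hd y) := by
    nth_rewrite 1 [← hA.resolvent_sub_smul_yosida hc x, ← hA.resolvent_sub_smul_yosida hd y]
    abel
  rw [e, inner_sub_left, Complex.sub_re]
  have h1 := hA.re_inner_resolvent_sub_nonpos hc hd x y
  have hM : 0 ≤ M := (norm_nonneg _).trans hx
  have n1 : ‖(c : ℂ) • hA.yosida hc x - (d : ℂ) • hA.yosida hd y‖ ≤ (c + d) * M := by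
    refine (norm_sub_le _ _).trans ?_
    rw [norm_smul, norm_smul, Complex.norm_of_nonneg hc.le, Complex.norm_of_nonneg hd.le, add_mul]
    gcongr
  have n2 : ‖hA.yosida hc x - hA.yosida hd y‖ ≤ 2 * M := by
    refine (norm_sub_le _ _).trans ?_
    linarith
  have h2 := (Complex.abs_re_le_norm _).trans (norm_inner_le_norm (𝕜 := ℂ)
    ((c : ℂ) • hA.yosida hc x - (d : ℂ) • hA.yosida hd y) (hA.yosida hc x - hA.yosida hd y))
  have h3 : ‖(c : ℂ) • hA.yosida hc x - (d : ℂ) • hA.yosida hd y‖ *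
      ‖hA.yosida hc x - hA.yosida hd y‖ ≤ (c + d) * M * (2 * M) :=
    mul_le_mul n1 n2 (norm_nonneg _) (by positivity)
  have h4 := neg_abs_le (inner ℂ ((c : ℂ) • hA.yosida hc x - (d : ℂ) • hA.yosida hd y)
    (hA.yosida hc x - hA.yosida hd y)).re
  nlinarith

lemma re_inner_yosida_nonpos (hA : IsMaximalDissipative A) {c : ℝ} (hc : 0 < c) (x : E) :
    (inner ℂ x (hA.yosida hc x)).re ≤ 0 := by
  have h1 := hA.re_inner_resolvent_sub_nonpos hc hc x 0
  simp only [map_zero, sub_zero] at h1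
  nth_rewrite 1 [← hA.resolvent_sub_smul_yosida hc x]
  rw [inner_sub_left, inner_smul_left, Complex.sub_re, Complex.conj_ofReal, Complex.re_ofReal_mul,
    re_inner_self]
  have : 0 ≤ c * ‖hA.yosida hc x‖ ^ 2 := by positivity
  linarith

/-! ### Convergence of the approximating flows -/

variable [CompleteSpace E]

/-- The group generated by the Yosida approximation. -/
def flow (hA : IsMaximalDissipative A) {c : ℝ} (hc : 0 < c) (t : ℝ) : E →L[ℂ] E :=
  NormedSpace.exp (t • hA.yosida hc)

lemma flow_zero (hA : IsMaximalDissipative A)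
    {c : ℝ} (hc : 0 < c) (x : E) : hA.flow hc 0 x = x := by
  simp [flow]

lemma hasDerivAt_flow (hA : IsMaximalDissipative A) {c : ℝ} (hc : 0 < c) (x : E) (t : ℝ) :
    HasDerivAt (fun t => hA.flow hc t x) (hA.yosida hc (hA.flow hc t x)) t := by
  have h := hasDerivAt_exp_smul_const' (𝕂 := ℝ) (hA.yosida hc) t
  exact ((ContinuousLinearMap.apply ℂ E x).restrictScalars ℝ).hasFDerivAt.comp_hasDerivAt t h

lemma continuous_flow (hA : IsMaximalDissipative A)
    {c : ℝ} (hc : 0 < c) (x : E) : Continuous fun t => hA.flow hc t x :=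
  continuous_iff_continuousAt.mpr fun t => (hA.hasDerivAt_flow hc x t).continuousAt

lemma yosida_flow (hA : IsMaximalDissipative A) {c : ℝ} (hc : 0 < c) (x : E) (t : ℝ) :
    hA.yosida hc (hA.flow hc t x) = hA.flow hc t (hA.yosida hc x) := by
  have h : Commute (hA.yosida hc) (hA.flow hc t) :=
    ((Commute.refl (hA.yosida hc)).smul_right t).exp_right
  exact DFunLike.congr_fun h.eq x

lemma norm_flow_le (hA : IsMaximalDissipative A) {c : ℝ} (hc : 0 < c) (x : E) {t : ℝ} (ht : 0 ≤ t) :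
    ‖hA.flow hc t x‖ ≤ ‖x‖ := by
  have := norm_sq_le_of_re_inner_le (hA.hasDerivAt_flow hc x)
    (fun s _ => hA.re_inner_yosida_nonpos hc _) ht
  rw [hA.flow_zero hc, mul_zero, zero_mul, add_zero] at this
  exact (sq_le_sq₀ (norm_nonneg _) (norm_nonneg _)).mp this

/-- The flow commutes with its generator and is contractive, so `‖A x‖` bounds the Yosida values
along both trajectories. The energy estimate then applies with `K = 2 (c + d) ‖A x‖²`. -/
lemma norm_flow_sub_flow_sq_le (hA : IsMaximalDissipative A)
    {c d : ℝ} (hc : 0 < c) (hd : 0 < d) (x : A.domain) {t : ℝ}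
    (ht : 0 ≤ t) :
    ‖hA.flow hc t x - hA.flow hd t x‖ ^ 2 ≤ 4 * (c + d) * ‖A x‖ ^ 2 * t := by
  have hM : ∀ {b : ℝ} (hb : 0 < b) (s : ℝ), 0 ≤ s → ‖hA.yosida hb (hA.flow hb s x)‖ ≤ ‖A x‖ := by
    intro b hb s hs
    rw [hA.yosida_flow hb]
    exact (hA.norm_flow_le hb _ hs).trans (hA.norm_yosida_le hb x)
  have := norm_sq_le_of_re_inner_le
    (fun s => (hA.hasDerivAt_flow hc (x : E) s).sub (hA.hasDerivAt_flow hd (x : E) s))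
    (fun s hs => hA.re_inner_yosida_sub_le hc hd _ _ (hM hc s hs) (hM hd s hs)) ht
  simp only [Pi.sub_apply, hA.flow_zero, sub_self, norm_zero] at this
  linarith

/-- The mild equation for the approximate flow; by `apply_resolvent` its right side is `A` at the
resolvent of the integral, the form in which closedness of `A` can be used. -/
lemma flow_integral (hA : IsMaximalDissipative A) {c : ℝ} (hc : 0 < c) (x : E) (t : ℝ) :
    hA.flow hc t x - x = hA.yosida hc (∫ s in (0 : ℝ)..t, hA.flow hc s x) := by
  rw [← ContinuousLinearMap.intervalIntegral_comp_comm _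
    ((hA.continuous_flow hc x).intervalIntegrable _ _),
    intervalIntegral.integral_eq_sub_of_hasDerivAt (fun s _ => hA.hasDerivAt_flow hc x s),
    hA.flow_zero hc]
  exact ((hA.yosida hc).continuous.comp (hA.continuous_flow hc x)).intervalIntegrable _ _

/-- The exponentials of the Yosida approximations with `c = 1 / (n + 1)` are Cauchy, uniformly on
bounded time intervals. -/
lemma uniformCauchySeqOn_flow (hA : IsMaximalDissipative A) (x : E) (T : ℝ) :
    UniformCauchySeqOn (fun (n : ℕ) t => hA.flow (Nat.one_div_pos_of_nat (α := ℝ) (n := n)) t x)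
      atTop (Icc 0 T) := by
  rw [Metric.uniformCauchySeqOn_iff]
  intro ε hε
  obtain ⟨y, hy, hxy⟩ := Metric.mem_closure_iff.mp (hA.dense_domain x) (ε / 3) (by positivity)
  -- The factor is twice the `4` of `norm_flow_sub_flow_sq_le`, so that the two parameters each
  -- contribute less than half of `(ε / 3) ^ 2`.
  obtain ⟨N, hN⟩ : ∃ N : ℕ, ∀ n ≥ N, 1 / ((n : ℝ) + 1) * (8 * ‖A ⟨y, hy⟩‖ ^ 2 * T)
      < (ε / 3) ^ 2 := by
    have h := (tendsto_one_div_add_atTop_nhds_zero_nat (𝕜 := ℝ)).mul_const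
      (8 * ‖A ⟨y, hy⟩‖ ^ 2 * T)
    rw [zero_mul] at h
    exact eventually_atTop.mp (h.eventually_lt_const (by positivity))
  refine ⟨N, fun m hm n hn t ht => ?_⟩
  have key : ∀ k : ℕ, dist (hA.flow (Nat.one_div_pos_of_nat (α := ℝ) (n := k)) t x)
      (hA.flow (Nat.one_div_pos_of_nat (α := ℝ) (n := k)) t y) < ε / 3 := fun k => by
    rw [dist_eq_norm, ← map_sub]
    refine (hA.norm_flow_le _ _ ht.1).trans_lt ?_
    rwa [← dist_eq_norm]
  have mid : dist (hA.flow (Nat.one_div_pos_of_nat (α := ℝ) (n := m)) t y)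
      (hA.flow (Nat.one_div_pos_of_nat (α := ℝ) (n := n)) t y) < ε / 3 := by
    rw [dist_eq_norm]
    refine lt_of_pow_lt_pow_left₀ 2 (by positivity) ?_
    refine (hA.norm_flow_sub_flow_sq_le _ _ ⟨y, hy⟩ ht.1).trans_lt ?_
    have h1 := hN m hm
    have h2 := hN n hn
    have h3 : 4 * (1 / ((m : ℝ) + 1) + 1 / ((n : ℝ) + 1)) * ‖A ⟨y, hy⟩‖ ^ 2 * t ≤
        4 * (1 / ((m : ℝ) + 1) + 1 / ((n : ℝ) + 1)) * ‖A ⟨y, hy⟩‖ ^ 2 * T := by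
      have := ht.2
      gcongr
    linarith
  have t1 := dist_triangle4 (hA.flow (Nat.one_div_pos_of_nat (α := ℝ) (n := m)) t x)
    (hA.flow (Nat.one_div_pos_of_nat (α := ℝ) (n := m)) t y)
    (hA.flow (Nat.one_div_pos_of_nat (α := ℝ) (n := n)) t y)
    (hA.flow (Nat.one_div_pos_of_nat (α := ℝ) (n := n)) t x)
  have k1 := key m
  have k2 := key n
  rw [dist_comm] at k2
  linarith

/-- `(1 - c A)⁻¹ y → y` as `c → 0`. -/
lemma tendsto_resolvent (hA : IsMaximalDissipative A) (y : E) :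
    Tendsto (fun n : ℕ => hA.resolvent (Nat.one_div_pos_of_nat (α := ℝ) (n := n)) y) atTop
      (𝓝 y) := by
  rw [Metric.tendsto_atTop]
  intro ε hε
  obtain ⟨z, hz, hyz⟩ := Metric.mem_closure_iff.mp (hA.dense_domain y) (ε / 3) (by positivity)
  obtain ⟨N, hN⟩ : ∃ N : ℕ, ∀ n ≥ N, 1 / ((n : ℝ) + 1) * ‖A ⟨z, hz⟩‖ < ε / 3 := by
    have h := (tendsto_one_div_add_atTop_nhds_zero_nat (𝕜 := ℝ)).mul_const ‖A ⟨z, hz⟩‖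
    rw [zero_mul] at h
    exact eventually_atTop.mp (h.eventually_lt_const (by positivity))
  refine ⟨N, fun n hn => ?_⟩
  have hc := Nat.one_div_pos_of_nat (α := ℝ) (n := n)
  have h1 : dist (hA.resolvent hc y) (hA.resolvent hc z) < ε / 3 := by
    rw [dist_eq_norm, ← map_sub]
    refine (hA.norm_resolvent_le _ _).trans_lt ?_
    rwa [← dist_eq_norm]
  have h2 : dist (hA.resolvent hc z) z < ε / 3 := by
    -- On the domain the error is `c` times a Yosida value, hence at most `c ‖A z‖`.
    have e : hA.resolvent hc z - z = ((1 / ((n : ℝ) + 1) : ℝ) : ℂ) • hA.yosida hc z := by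
      nth_rewrite 2 [← hA.resolvent_sub_smul_yosida hc z]
      abel
    rw [dist_eq_norm, e, norm_smul, Complex.norm_of_nonneg hc.le]
    refine lt_of_le_of_lt ?_ (hN n hn)
    gcongr
    exact hA.norm_yosida_le hc ⟨z, hz⟩
  have t1 := dist_triangle4 (hA.resolvent hc y) (hA.resolvent hc z) z y
  rw [dist_comm] at hyz
  linarith

/-! ### Well-posedness of the abstract Cauchy problem -/

/-- The limit of the approximate flows is continuous by locally uniform convergence. Its mild
equation is the limit of `flow_integral`: the resolvents of the integrals converge to `∫ U`, their
images under `A` converge to `U t - x`, and `A` is closed. -/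
lemma exists_isMildSolution (hA : IsMaximalDissipative A)
    (x : E) : ∃ U : C(ℝ≥0, E), IsMildSolution A x U := by
  have hcauchy := hA.uniformCauchySeqOn_flow x
  have hex : ∀ t : ℝ≥0, ∃ y, Tendsto
      (fun n : ℕ => hA.flow (Nat.one_div_pos_of_nat (α := ℝ) (n := n)) t x) atTop (𝓝 y) :=
    fun t => cauchySeq_tendsto_of_complete
      ((hcauchy t).cauchySeq ⟨t.coe_nonneg, le_rfl⟩)
  choose U hU using hex
  have hcont : Continuous U := by
    have hloc : TendstoLocallyUniformly (fun (n : ℕ) (t : ℝ≥0) =>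
        hA.flow (Nat.one_div_pos_of_nat (α := ℝ) (n := n)) t x) U atTop := by
      intro S hS t
      refine ⟨Iic (t + 1), Iic_mem_nhds (by simp), ?_⟩
      have hc : UniformCauchySeqOn (fun (n : ℕ) (t : ℝ≥0) =>
          hA.flow (Nat.one_div_pos_of_nat (α := ℝ) (n := n)) t x) atTop (Iic (t + 1)) := by
        refine ((hcauchy (t + 1)).comp NNReal.toReal).mono fun s hs => ?_
        exact ⟨s.coe_nonneg, by exact_mod_cast hs⟩
      exact (hc.tendstoUniformlyOn_of_tendsto fun s _ => hU s) S hS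
    refine hloc.continuous (Frequently.of_forall fun n => ?_)
    exact (hA.continuous_flow _ x).comp NNReal.continuous_coe
  refine ⟨⟨U, hcont⟩, fun t => ?_⟩
  have hint : Tendsto (fun n : ℕ => ∫ s in (0 : ℝ)..t,
      hA.flow (Nat.one_div_pos_of_nat (α := ℝ) (n := n)) s x) atTop
      (𝓝 (∫ s in (0 : ℝ)..t, U s.toNNReal)) := by
    refine intervalIntegral.tendsto_integral_filter_of_dominated_convergence (fun _ => ‖x‖)
      (Eventually.of_forall fun n => (hA.continuous_flow _ x).aestronglyMeasurable)
      (Eventually.of_forall fun n => Eventually.of_forall fun s hs => ?_)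
      intervalIntegrable_const (Eventually.of_forall fun s hs => ?_)
    · rw [uIoc_of_le t.coe_nonneg] at hs
      exact hA.norm_flow_le _ x hs.1.le
    · rw [uIoc_of_le t.coe_nonneg] at hs
      have := hU s.toNNReal
      rwa [Real.coe_toNNReal s hs.1.le] at this
  have hres : Tendsto (fun n : ℕ => hA.resolvent (Nat.one_div_pos_of_nat (α := ℝ) (n := n))
      (∫ s in (0 : ℝ)..t, hA.flow (Nat.one_div_pos_of_nat (α := ℝ) (n := n)) s x)) atTop
      (𝓝 (∫ s in (0 : ℝ)..t, U s.toNNReal)) := by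
    -- Operator and argument both vary with `n`; contractivity of the resolvents disposes of the
    -- varying argument.
    have h1 : Tendsto (fun n : ℕ => hA.resolvent (Nat.one_div_pos_of_nat (α := ℝ) (n := n))
        ((∫ s in (0 : ℝ)..t, hA.flow (Nat.one_div_pos_of_nat (α := ℝ) (n := n)) s x)
          - ∫ s in (0 : ℝ)..t, U s.toNNReal)) atTop (𝓝 0) :=
      squeeze_zero_norm (fun n => hA.norm_resolvent_le _ _)
        (tendsto_iff_norm_sub_tendsto_zero.mp hint)
    have h2 := h1.add (hA.tendsto_resolvent (∫ s in (0 : ℝ)..t, U s.toNNReal))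
    rw [zero_add] at h2
    refine h2.congr fun n => ?_
    rw [← map_add, sub_add_cancel]
  obtain ⟨h, e⟩ := hA.mem_graph_of_tendsto (fun n => by
    obtain ⟨h, e⟩ := hA.apply_resolvent (Nat.one_div_pos_of_nat (α := ℝ) (n := n))
      (∫ s in (0 : ℝ)..t, hA.flow (Nat.one_div_pos_of_nat (α := ℝ) (n := n)) s x)
    exact ⟨h, e.trans (hA.flow_integral _ x t).symm⟩) hres ((hU t).sub_const x)
  refine ⟨h, ?_⟩
  change U t = _
  exact (eq_add_of_sub_eq' e.symm)

lemma continuous_comp_toNNReal {F : Type*} [TopologicalSpace F] (U : C(ℝ≥0, F)) :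
    Continuous fun s : ℝ => U s.toNNReal :=
  U.continuous.comp continuous_real_toNNReal

lemma hasDerivAt_integral_toNNReal (U : C(ℝ≥0, E)) (t : ℝ) :
    HasDerivAt (fun t => ∫ s in (0 : ℝ)..t, U s.toNNReal) (U t.toNNReal) t :=
  ((continuous_comp_toNNReal U).integral_hasStrictDerivAt 0 t).hasDerivAt

/-- A difference of mild solutions need not lie in the domain, but its integral `W` does and solves
`W' = A W`, `W 0 = 0` on `[0, ∞)`. The energy estimate with `K = 0` gives `W = 0`, and then `U - V =
A W = 0`. -/
lemma isMildSolution_unique (hA : IsMaximalDissipative A)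
    {x : E} {U V : C(ℝ≥0, E)} (hU : IsMildSolution A x U)
    (hV : IsMildSolution A x V) : U = V := by
  let W : ℝ → E := fun t => (∫ s in (0 : ℝ)..t, U s.toNNReal) - ∫ s in (0 : ℝ)..t, V s.toNNReal
  have hW : ∀ t : ℝ≥0, ∃ h : W t ∈ A.domain, A ⟨W t, h⟩ = U t - V t := fun t => by
    obtain ⟨h, e⟩ := hU t
    obtain ⟨h', e'⟩ := hV t
    refine ⟨sub_mem h h', ?_⟩
    have := A.map_sub ⟨_, h⟩ ⟨_, h'⟩
    rw [e, e', add_sub_add_left_eq_sub]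
    exact this
  have hd : ∀ t : ℝ, HasDerivAt W (U t.toNNReal - V t.toNNReal) t := fun t =>
    (hasDerivAt_integral_toNNReal U t).sub (hasDerivAt_integral_toNNReal V t)
  have hW0 : ∀ t : ℝ≥0, W t = 0 := fun t => by
    have := norm_sq_le_of_re_inner_le hd (K := 0) (fun s hs => by
      obtain ⟨h, e⟩ := hW s.toNNReal
      rw [← e]
      have := hA.re_inner_nonpos ⟨_, h⟩
      simpa only [Real.coe_toNNReal s hs] using this) t.coe_nonneg
    have w0 : W 0 = 0 := by simp [W]
    rw [w0] at this
    simp only [norm_zero, mul_zero, zero_mul, add_zero, ne_eq, OfNat.ofNat_ne_zero,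
      not_false_eq_true, zero_pow] at this
    exact norm_eq_zero.mp (pow_eq_zero_iff two_ne_zero |>.mp (le_antisymm this (by positivity)))
  ext t
  obtain ⟨h, e⟩ := hW t
  have h0 : (⟨W t, h⟩ : A.domain) = 0 := Subtype.ext (hW0 t)
  rw [h0, A.map_zero] at e
  exact (sub_eq_zero.mp e.symm)

/-- If `W` is the mild solution starting at `A x`, then `x + ∫ W` is the mild solution starting
at `x`. -/
lemma isMildSolution_add_integral (hA : IsMaximalDissipative A)
    (x : A.domain) {W : C(ℝ≥0, E)} (hW : IsMildSolution A (A x) W)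
    {U : C(ℝ≥0, E)} (hU : ∀ t : ℝ≥0, U t = x + ∫ s in (0 : ℝ)..t, W s.toNNReal) :
    IsMildSolution A x U := by
  intro t
  -- The mild equation of `W` reads `A (x + ∫ W) = W`; integrating it gives `A ∫ U = ∫ W = U - x`.
  have hUW : ∀ s : ℝ≥0, ∃ h : U s ∈ A.domain, A ⟨U s, h⟩ = W s := fun s => by
    obtain ⟨h, e⟩ := hW s
    rw [e, hU s]
    exact ⟨add_mem x.2 h, A.map_add x ⟨_, h⟩⟩
  obtain ⟨h, e⟩ := hA.integral_mem_graph (continuous_comp_toNNReal U) (continuous_comp_toNNReal W)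
    t.coe_nonneg fun s _ => hUW s.toNNReal
  exact ⟨h, by rw [e, hU]⟩

theorem existsUnique_isMildSolution (hA : IsMaximalDissipative A)
    (x : E) : ∃! U : C(ℝ≥0, E), IsMildSolution A x U := by
  obtain ⟨U, hU⟩ := hA.exists_isMildSolution x
  exact ⟨U, hU, fun V hV => hA.isMildSolution_unique hV hU⟩

/-- With `W` the mild solution starting at `A x`, uniqueness forces `U = x + ∫ W`. Hence `U' = W = A
U` with `W` continuous, and all three claims follow. -/
theorem regularity (hA : IsMaximalDissipative A)
    {x : E} (hx : x ∈ A.domain) {U : C(ℝ≥0, E)} (hU : IsMildSolution A x U) :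
    IsC1 U ∧ IsContInDomain A U ∧ IsStrongSolution A x U := by
  obtain ⟨W, hW⟩ := hA.exists_isMildSolution (A ⟨x, hx⟩)
  have hcont : Continuous fun t : ℝ => ∫ s in (0 : ℝ)..t, W s.toNNReal :=
    continuous_iff_continuousAt.mpr fun t => (hasDerivAt_integral_toNNReal W t).continuousAt
  have hUW : ∀ t : ℝ≥0, U t = x + ∫ s in (0 : ℝ)..t, W s.toNNReal := by
    have := hA.isMildSolution_unique hU (hA.isMildSolution_add_integral ⟨x, hx⟩ hW
      (U := ⟨fun t => x + ∫ s in (0 : ℝ)..t, W s.toNNReal,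
        continuous_const.add (hcont.comp NNReal.continuous_coe)⟩) fun _ => rfl)
    intro t
    nth_rewrite 1 [this]
    rfl
  have hgraph : ∀ t : ℝ≥0, ∃ h : U t ∈ A.domain, A ⟨U t, h⟩ = W t := fun t => by
    obtain ⟨h, e⟩ := hW t
    rw [e, hUW t]
    exact ⟨add_mem hx h, A.map_add ⟨x, hx⟩ ⟨_, h⟩⟩
  have hd : ∀ t ∈ Ici (0 : ℝ),
      HasDerivWithinAt (fun s : ℝ => U s.toNNReal) (W t.toNNReal) (Ici 0) t := by
    intro t ht
    refine ((hasDerivAt_integral_toNNReal W t).const_add x).hasDerivWithinAt.congr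
      (fun s hs => ?_) ?_
    · rw [hUW, Real.coe_toNNReal s hs]
    · rw [hUW, Real.coe_toNNReal t ht]
  refine ⟨?_, ⟨fun t => (hgraph t).1, ?_⟩, ?_, fun t => ⟨(hgraph t).1, ?_⟩⟩
  · rw [IsC1, contDiffOn_one_iff_derivWithin (uniqueDiffOn_Ici 0)]
    refine ⟨fun t ht => (hd t ht).differentiableWithinAt, ?_⟩
    refine (continuous_comp_toNNReal W).continuousOn.congr fun t ht => ?_
    exact (hd t ht).derivWithin (uniqueDiffOn_Ici 0 t ht)
  · refine U.continuous.prodMk (W.continuous.congr fun t => ?_)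
    exact (hgraph t).2.symm
  · rw [hUW]
    simp
  · have := hd t t.coe_nonneg
    rw [Real.toNNReal_coe] at this
    rwa [(hgraph t).2]

end IsMaximalDissipative

/-! ### Integration by parts and weak derivatives -/

section WeakDerivatives

variable {L : ℝ}

lemma IsTest.star {φ : ℝ → ℂ} (h : IsTest L φ) : IsTest L (star φ) where
  smooth := Complex.conjCLE.contDiff.comp h.smooth
  compact := h.compact.comp_left (g := fun z : ℂ => conj z) (by simp)
  supp := (closure_mono fun x hx => by simpa using hx).trans h.supp

lemma deriv_star_eq (φ : ℝ → ℂ) : deriv (star φ) = star (deriv φ) := by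
  funext x
  exact deriv.star

lemma inner_eq_integral {z : L2 L} {φ : ℝ → ℂ} (h : z =ᵐ[vol L] star φ) (f : L2 L) :
    inner ℂ z f = ∫ x, f x * φ x ∂(vol L) := by
  rw [L2.inner_def]
  refine integral_congr_ae ?_
  filter_upwards [h] with x hx
  simp [hx, RCLike.inner_apply]

/-- Integration by parts between `H¹₀` and `H¹`. -/
lemma inner_dx0_left (g : H10 L) (f : H1 L) :
    inner ℂ (dx0 L g) (f : L2 L) = -inner ℂ (g : L2 L) (dx L f) := by
  have hcl : closure (testGraph L : Set (L2 L × L2 L)) ⊆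
      {z | inner ℂ z.2 (f : L2 L) = -inner ℂ z.1 (dx L f)} := by
    refine closure_minimal ?_ (isClosed_eq (by fun_prop) (by fun_prop))
    rintro z ⟨φ, hφ, h1, h2⟩
    -- The inner product conjugates its first argument, so the weak derivative is tested against the
    -- conjugate of `φ`. The closure argument then carries the identity from test functions to
    -- `H¹₀`.
    have := dx_spec f (Star.star φ) hφ.star
    rw [mem_ofPred_eq, inner_eq_integral (z := z.1) (φ := Star.star φ) (by simpa using h1),
      inner_eq_integral (z := z.2) (φ := deriv (Star.star φ)) (by simpa [deriv_star_eq] using h2),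
      this]
  exact hcl (dx0_mem g)

lemma inner_dx0_right (g : H10 L) (f : H1 L) :
    inner ℂ (f : L2 L) (dx0 L g) = -inner ℂ (dx L f) (g : L2 L) := by
  rw [← inner_conj_symm, inner_dx0_left, map_neg, inner_conj_symm]

/-- Turns a variational equation into regularity: a flux `b` appearing against the derivatives of
test functions acquires the weak derivative `a`. -/
lemma mem_weakGraph_of_inner {a b : L2 L}
    (h : ∀ z ∈ testGraph L, inner ℂ z.1 a + inner ℂ z.2 b = 0) : (b, a) ∈ weakGraph L := by
  intro φ hφ
  have e := h (hφ.star.memLp.toLp, hφ.star.deriv.memLp.toLp)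
    ⟨Star.star φ, hφ.star, hφ.star.memLp.coeFn_toLp, hφ.star.deriv.memLp.coeFn_toLp⟩
  rw [inner_eq_integral hφ.star.memLp.coeFn_toLp, inner_eq_integral (φ := deriv φ)
    (hφ.star.deriv.memLp.coeFn_toLp.trans (by rw [deriv_star_eq])), add_comm] at e
  exact eq_neg_of_add_eq_zero_left e

/-- Multiplication by the continuous function `a` as a bounded operator on `L²(0, L)`. -/
def mulCLM (a : ℝ → ℝ) (ha : ContinuousOn a (Icc 0 L)) : L2 L →L[ℂ] L2 L :=
  LinearMap.mkContinuousOfExistsBound (mulL2 a ha) <| by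
    obtain ⟨C, hC⟩ := isCompact_Icc.exists_bound_of_continuousOn ha
    refine ⟨C, fun f => Lp.norm_le_mul_norm_of_ae_le_mul ?_⟩
    filter_upwards [(memLp_mul ha f).coeFn_toLp, ae_restrict_mem measurableSet_Ioo] with x hx hxm
    erw [hx]
    rw [norm_mul, Complex.norm_real]
    exact mul_le_mul_of_nonneg_right (hC x (Ioo_subset_Icc_self hxm)) (norm_nonneg _)

@[simp] lemma mulCLM_apply (a : ℝ → ℝ) (ha : ContinuousOn a (Icc 0 L)) (f : L2 L) :
    mulCLM a ha f = mulL2 a ha f := rfl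

lemma mulL2_mulL2_inv {a : ℝ → ℝ} (ha : ContinuousOn a (Icc 0 L))
    (ha' : ContinuousOn (fun x => 1 / a x) (Icc 0 L)) (hpos : ∀ x ∈ Icc 0 L, 0 < a x)
    (f : L2 L) : mulL2 a ha (mulL2 (fun x => 1 / a x) ha' f) = f := by
  refine Lp.ext ?_
  refine (memLp_mul ha _).coeFn_toLp.trans ?_
  filter_upwards [(memLp_mul ha' f).coeFn_toLp, ae_restrict_mem measurableSet_Ioo] with x hx hxm
  have h0 : (a x : ℂ) ≠ 0 := by exact_mod_cast (hpos x (Ioo_subset_Icc_self hxm)).ne'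
  erw [hx]
  push_cast
  field_simp

lemma mulL2_inv_mulL2 {a : ℝ → ℝ} (ha : ContinuousOn a (Icc 0 L))
    (ha' : ContinuousOn (fun x => 1 / a x) (Icc 0 L)) (hpos : ∀ x ∈ Icc 0 L, 0 < a x)
    (f : L2 L) : mulL2 (fun x => 1 / a x) ha' (mulL2 a ha f) = f := by
  refine Lp.ext ?_
  refine (memLp_mul ha' _).coeFn_toLp.trans ?_
  filter_upwards [(memLp_mul ha f).coeFn_toLp, ae_restrict_mem measurableSet_Ioo] with x hx hxm
  have h0 : (a x : ℂ) ≠ 0 := by exact_mod_cast (hpos x (Ioo_subset_Icc_self hxm)).ne'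
  erw [hx]
  push_cast
  field_simp

end WeakDerivatives

/-! ### Coercive problems -/

section Coercive

/-- A coercive bounded operator on a complex Hilbert space is surjective. -/
lemma surjective_of_coercive {V : Type*} [NormedAddCommGroup V] [InnerProductSpace ℂ V]
    [CompleteSpace V] (T : V →L[ℂ] V) {c : ℝ} (hc : 0 < c)
    (hT : ∀ v, c * ‖v‖ ^ 2 ≤ (inner ℂ v (T v)).re) : Function.Surjective T := by
  have hb : ∀ v, c * ‖v‖ ≤ ‖T v‖ := fun v => by
    have h1 := (hT v).trans ((Complex.re_le_norm _).trans (norm_inner_le_norm v (T v)))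
    rcases (norm_nonneg v).eq_or_lt with h0 | h0
    · rw [← h0, mul_zero]
      exact norm_nonneg _
    · exact le_of_mul_le_mul_left (by nlinarith) h0
  have hanti : AntilipschitzWith (Real.toNNReal c⁻¹) T := by
    refine AddMonoidHomClass.antilipschitz_of_bound T fun v => ?_
    rw [Real.coe_toNNReal _ (by positivity), inv_mul_eq_div, le_div_iff₀ hc, mul_comm]
    exact hb v
  -- The lower bound closes the range, and coercivity at a vector orthogonal to the range makes that
  -- vector zero.
  have hclosed : IsClosed (T.range : Set V) := hanti.isClosed_range T.uniformContinuous
  have hbot : T.rangeᗮ = ⊥ := by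
    rw [Submodule.eq_bot_iff]
    intro y hy
    have h0 : inner ℂ (T y) y = 0 := hy (T y) ⟨y, rfl⟩
    have h1 := hT y
    rw [← inner_conj_symm, h0, map_zero, Complex.zero_re] at h1
    have h2 : ‖y‖ ^ 2 ≤ 0 := nonpos_of_mul_nonpos_right h1 hc
    exact norm_eq_zero.mp (pow_eq_zero_iff two_ne_zero |>.mp (le_antisymm h2 (by positivity)))
  have htop := Submodule.topologicalClosure_eq_top_iff.mpr hbot
  rw [hclosed.submodule_topologicalClosure_eq] at htop
  exact LinearMap.range_eq_top.mp htop

/-- The Lax–Milgram theorem on a closed subspace. -/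
lemma exists_inner_eq_of_coercive {E : Type*} [NormedAddCommGroup E] [InnerProductSpace ℂ E]
    [CompleteSpace E] {V : Submodule ℂ E} (hV : IsClosed (V : Set E)) (M : E →L[ℂ] E) {c : ℝ}
    (hc : 0 < c) (hM : ∀ z, c * ‖z‖ ^ 2 ≤ (inner ℂ z (M z)).re) (f : E) :
    ∃ z ∈ V, ∀ v ∈ V, inner ℂ v (M z) = inner ℂ v f := by
  have : CompleteSpace V := hV.completeSpace_coe
  -- The compression of `M` to `V` inherits coercivity, since the projection is invisible when
  -- paired with vectors of `V`.
  obtain ⟨z, hz⟩ := surjective_of_coercive (V.orthogonalProjectionOnto ∘L M ∘L V.subtypeL) hc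
    (fun v => by
      have := hM v
      simpa using this) (V.orthogonalProjectionOnto f)
  refine ⟨z, z.2, fun v hv => ?_⟩
  have h1 := Submodule.inner_orthogonalProjectionOnto_eq_of_mem_left (K := V) ⟨v, hv⟩ (M z)
  have h2 := Submodule.inner_orthogonalProjectionOnto_eq_of_mem_left (K := V) ⟨v, hv⟩ f
  rw [← h1, ← h2, ← hz]
  rfl

variable {L : ℝ}

/-- The space of quadruples of `L²` functions, with its Hilbert norm. -/
abbrev Quad (L : ℝ) : Type := PiLp 2 fun _ : Fin 4 => L2 L

/-- The quadruples `(v, v_x, r, r_x)` with `v, r ∈ H¹₀`. -/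
def quadH10 (L : ℝ) : Submodule ℂ (Quad L) where
  carrier := {z | (z 0, z 1) ∈ (testGraph L).topologicalClosure ∧
    (z 2, z 3) ∈ (testGraph L).topologicalClosure}
  zero_mem' := ⟨zero_mem _, zero_mem _⟩
  add_mem' h h' := ⟨add_mem h.1 h'.1, add_mem h.2 h'.2⟩
  smul_mem' c _ h := ⟨Submodule.smul_mem _ c h.1, Submodule.smul_mem _ c h.2⟩

lemma isClosed_quadH10 : IsClosed (quadH10 L : Set (Quad L)) := by
  have h := (testGraph L).isClosed_topologicalClosure
  exact (h.preimage (f := fun z : Quad L => (z 0, z 1)) (by fun_prop)).inter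
    (h.preimage (f := fun z : Quad L => (z 2, z 3)) (by fun_prop))

/-- Weak solvability in `H¹₀ × H¹₀` of a coercive system of two second-order equations. -/
lemma exists_weak_solution (M : Fin 4 → Quad L →L[ℂ] L2 L) {e : Fin 4 → ℝ} (he : ∀ i, 0 < e i)
    (hM : ∀ z : Quad L, ∑ i, e i * ‖z i‖ ^ 2 ≤ (∑ i, inner ℂ (z i) (M i z)).re)
    (F : Fin 4 → L2 L) :
    ∃ (v r : H10 L) (z : Quad L), z 0 = v ∧ z 1 = dx0 L v ∧ z 2 = r ∧ z 3 = dx0 L r ∧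
      (M 1 z - F 1, M 0 z - F 0) ∈ weakGraph L ∧ (M 3 z - F 3, M 2 z - F 2) ∈ weakGraph L := by
  let M' : Quad L →L[ℂ] Quad L :=
    (PiLp.continuousLinearEquiv 2 ℂ fun _ : Fin 4 => L2 L).symm.toContinuousLinearMap ∘L
      ContinuousLinearMap.pi M
  obtain ⟨i₀, -, hi₀⟩ := Finset.exists_min_image Finset.univ e Finset.univ_nonempty
  obtain ⟨z, ⟨hz1, hz2⟩, hz⟩ := exists_inner_eq_of_coercive isClosed_quadH10 M' (he i₀)
    (fun z => by
      refine le_trans ?_ (hM z)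
      rw [PiLp.norm_sq_eq_of_L2, Finset.mul_sum]
      gcongr with i
      exact hi₀ i (Finset.mem_univ i)) (WithLp.toLp 2 F)
  have hz' : ∀ v ∈ quadH10 L, ∑ i, inner ℂ (v i) (M i z - F i) = 0 := fun v hv => by
    have := hz v hv
    rw [← sub_eq_zero, ← inner_sub_right, PiLp.inner_apply] at this
    exact this
  have hd : ∀ (x y : L2 L) (h : (x, y) ∈ (testGraph L).topologicalClosure),
      dx0 L ⟨x, (x, y), h, rfl⟩ = y := fun x y h => dx_eq (closure_testGraph_le h) _
  refine ⟨⟨z 0, _, hz1, rfl⟩, ⟨z 2, _, hz2, rfl⟩, z, rfl, (hd _ _ hz1).symm, rfl,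
    (hd _ _ hz2).symm, ?_, ?_⟩
  · refine mem_weakGraph_of_inner fun y hy => ?_
    -- Test pairs placed in one half of the quadruple isolate one of the two equations.
    have := hz' (WithLp.toLp 2 ![y.1, y.2, 0, 0]) ⟨subset_closure hy, zero_mem _⟩
    simpa [Fin.sum_univ_four] using this
  · refine mem_weakGraph_of_inner fun y hy => ?_
    have := hz' (WithLp.toLp 2 ![0, 0, y.1, y.2]) ⟨zero_mem _, subset_closure hy⟩
    simpa [Fin.sum_univ_four] using this

end Coercive

/-! ### The operator is maximal dissipative -/

section Generation

open PhaseSpace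

variable {B : Beam} {bc : Boundary}

lemma re_inner_mulL2_nonneg {L : ℝ} {a : ℝ → ℝ} (hL : 0 < L) (ha : ContinuousOn a (Icc 0 L))
    (hpos : ∀ x ∈ Icc 0 L, 0 < a x) (f : L2 L) : 0 ≤ (inner ℂ f (mulL2 a ha f)).re := by
  obtain ⟨c, C, hc, hC, h⟩ := wform_bounds hL ha hpos
  rw [← wform_eq_inner]
  exact le_trans (by positivity) (h f).1

lemma mulL2_one {L : ℝ} (f : L2 L) : mulL2 (fun _ => 1) continuousOn_const f = f := by
  refine Lp.ext ((memLp_mul continuousOn_const f).coeFn_toLp.trans ?_)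
  simp

lemma inner_mulL2_right {L : ℝ} {a : ℝ → ℝ} (ha : ContinuousOn a (Icc 0 L)) (f g : L2 L) :
    inner ℂ g (mulL2 a ha f) = conj (inner ℂ f (mulL2 a ha g)) := by
  rw [← wform_eq_inner, ← wform_eq_inner, wform_conj]

lemma dx_coe_eq_dx0 {L : ℝ} {f : H1 L} {g : H10 L} (h : (f : L2 L) = g) : dx L f = dx0 L g := by
  have : f = Submodule.inclusion H10_le_H1 g := Subtype.ext h
  rw [this]
  rfl

/-- `q_x` and `θ_x` are formally skew-adjoint to each other: one of `θ`, `q` vanishes at the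
ends. -/
lemma inner_dx_q_add_inner_dx_θ (U : opDomain B bc) :
    inner ℂ (θ1 U : L2 B.L) (dx B.L (q1 U)) + conj (inner ℂ (q1 U : L2 B.L) (dx B.L (θ1 U)))
      = 0 := by
  obtain ⟨U, hU, hθ, hq⟩ := U
  rw [inner_conj_symm]
  cases bc with
  | temperature =>
    rw [dx_coe_eq_dx0 (f := θ1 ⟨U, hU, hθ, hq⟩) (g := ⟨θ U, hθ⟩) rfl, inner_dx0_left]
    exact add_neg_cancel _
  | flux =>
    rw [dx_coe_eq_dx0 (f := q1 ⟨U, hU, hθ, hq⟩) (g := ⟨q U, hq⟩) rfl, inner_dx0_right]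
    exact neg_add_cancel _

/-- After integration by parts, the elastic terms and the `η`-couplings cancel in conjugate pairs,
and the `κ`-couplings cancel by the boundary conditions. Only the viscous damping `2 δ` and the
relaxation term `β` remain. -/
lemma re_inner_op (U : opDomain B bc) :
    (inner ℂ (U : PhaseSpace B) (opFun U)).re =
      -(2 * (inner ℂ (dx0 B.L (w0 U)) (mulL2 B.δ B.δ_cont (dx0 B.L (w0 U)))).re)
        - B.β * ‖q (U : PhaseSpace B)‖ ^ 2 := by
  have hσ := inner_dx0_left (w0 U) (stress1 U - (B.η : ℂ) • θ1 U)
  have hσ' : inner ℂ (w (U : PhaseSpace B)) (dx B.L (stress1 U - (B.η : ℂ) • θ1 U)) =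
      -(inner ℂ (dx0 B.L (w0 U)) (mulL2 B.p B.p_cont (dx0 B.L (u (U : PhaseSpace B))))
        + 2 * inner ℂ (dx0 B.L (w0 U)) (mulL2 B.δ B.δ_cont (dx0 B.L (w0 U)))
        - B.η * inner ℂ (dx0 B.L (w0 U)) (θ (U : PhaseSpace B))) := by
    rw [eq_neg_iff_add_eq_zero, ← sub_neg_eq_add, sub_eq_zero]
    refine (neg_eq_iff_eq_neg.mp hσ.symm |>.trans ?_)
    rw [neg_inj, Submodule.coe_sub, Submodule.coe_smul]
    change inner ℂ _ (stress B _ (w0 U) - (B.η : ℂ) • θ (U : PhaseSpace B)) = _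
    rw [stress, inner_sub_right, inner_add_right, inner_smul_right, inner_smul_right]
  have hτ : (B.τ : ℂ) ≠ 0 := by exact_mod_cast B.τ_pos.ne'
  have hpw := inner_mulL2_right B.p_cont (dx0 B.L (u (U : PhaseSpace B))) (dx0 B.L (w0 U))
  have hθq := inner_dx_q_add_inner_dx_θ U
  have hθw := inner_conj_symm (𝕜 := ℂ) (θ (U : PhaseSpace B)) (dx0 B.L (w0 U))
  change inner ℂ (θ (U : PhaseSpace B)) _ + conj (inner ℂ (q (U : PhaseSpace B)) _) = 0 at hθq
  have hq := re_inner_self (q (U : PhaseSpace B))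
  rw [inner_eq, form, wform_eq_inner B.p_cont, wform_eq_inner B.m_cont,
    wform_eq_inner (a := fun _ => 1) continuousOn_const,
    wform_eq_inner (a := fun _ => 1) continuousOn_const, mulL2_one, mulL2_one, opFun, u_mk, w_mk,
    θ_mk, q_mk, mulL2_mulL2_inv B.m_cont _ B.m_pos, hσ']
  simp only [inner_sub_right, inner_neg_right, inner_smul_right, inner_add_right]
  have e : ∀ z : ℂ, (B.τ : ℂ) * (-1 / B.τ * z) = -z := fun z => by field_simp
  have e₂ : ∀ z : ℂ, (2 * z).re = 2 * z.re := fun z => by simp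
  rw [e, hpw]
  rw [← hθw]
  generalize inner ℂ (θ (U : PhaseSpace B)) (dx B.L (q1 U)) = a at *
  generalize inner ℂ (q (U : PhaseSpace B)) (dx B.L (θ1 U)) = b at *
  have hab : a.re + b.re = 0 := by simpa using congrArg Complex.re hθq
  simp only [Complex.add_re, Complex.sub_re, Complex.neg_re, Complex.re_ofReal_mul,
    Complex.conj_re, hq, e₂]
  linear_combination (-B.κ) * hab

lemma re_inner_op_nonpos (U : opDomain B bc) :
    (inner ℂ (U : PhaseSpace B) (opFun U)).re ≤ 0 := by
  rw [re_inner_op]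
  have h1 := re_inner_mulL2_nonneg B.L_pos B.δ_cont B.δ_pos (dx0 B.L (w0 U))
  have h2 : 0 ≤ B.β * ‖q (U : PhaseSpace B)‖ ^ 2 := mul_nonneg B.β_pos.le (by positivity)
  linarith

/-- A solution of the stationary equations in weak form gives a preimage under `1 - c A`. -/
lemma exists_sub_smul_eq_of_weak {c : ℝ} (hc : 0 < c) (F : PhaseSpace B) (v : H10 B.L)
    {θ' q' θx qx : L2 B.L} (hθ : θ' ∈ bc.θSpace B.L) (hq : q' ∈ bc.qSpace B.L)
    (hσ : ((c : ℂ) • (stress B (u F + (c : ℂ) • v) v - (B.η : ℂ) • θ'),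
      mulL2 B.m B.m_cont (v : L2 B.L) - mulL2 B.m B.m_cont (w F)) ∈ weakGraph B.L)
    (hθx : (θ', θx) ∈ weakGraph B.L) (hqx : (q', qx) ∈ weakGraph B.L)
    (eθ : θ' + (c : ℂ) • ((B.κ : ℂ) • qx + (B.η : ℂ) • dx0 B.L v) = θ F)
    (eq : (B.τ : ℂ) • q' + (c : ℂ) • ((B.κ : ℂ) • θx + (B.β : ℂ) • q') = (B.τ : ℂ) • q F) :
    ∃ U : opDomain B bc, (U : PhaseSpace B) - (c : ℂ) • opFun U = F := by
  have hc' : (c : ℂ) ≠ 0 := by exact_mod_cast hc.ne'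
  have hτ : (B.τ : ℂ) ≠ 0 := by exact_mod_cast B.τ_pos.ne'
  have hσ₁ := (weakGraph B.L).smul_mem (c : ℂ)⁻¹ hσ
  rw [Prod.smul_mk, inv_smul_smul₀ hc'] at hσ₁
  -- The weak equation controls only stress minus `η θ`; adding `η θ_x` back puts the stress itself
  -- in `H¹`, as the domain requires.
  have hσ₂ := (weakGraph B.L).add_mem hσ₁ ((weakGraph B.L).smul_mem (B.η : ℂ) hθx)
  rw [Prod.smul_mk, Prod.mk_add_mk, sub_add_cancel] at hσ₂
  let U : opDomain B bc := ⟨mk (u F + (c : ℂ) • v) v θ' q',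
    ⟨v.2, mem_H1_iff.mpr ⟨_, hσ₂⟩⟩, hθ, hq⟩
  refine ⟨U, ?_⟩
  have d1 : dx B.L (stress1 U - (B.η : ℂ) • θ1 U) =
      (c : ℂ)⁻¹ • (mulL2 B.m B.m_cont (v : L2 B.L) - mulL2 B.m B.m_cont (w F)) :=
    dx_eq hσ₁ _
  have d2 : dx B.L (q1 U) = qx := dx_eq hqx _
  have d3 : dx B.L (θ1 U) = θx := dx_eq hθx _
  have d4 : w0 U = v := rfl
  refine ext' ?_ ?_ ?_ ?_
  · simp only [map_sub, map_smul, opFun, u_mk, d4]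
    change u F + (c : ℂ) • v - (c : ℂ) • v = u F
    abel
  · simp only [map_sub, map_smul, opFun, w_mk, d1, smul_inv_smul₀ hc',
      mulL2_inv_mulL2 B.m_cont _ B.m_pos]
    change (v : L2 B.L) - ((v : L2 B.L) - w F) = w F
    abel
  · simp only [map_sub, map_smul, opFun, θ_mk, d2, d4]
    change θ' - _ = θ F
    rw [← eθ]
    module
  · simp only [map_sub, map_smul, opFun, q_mk, d3]
    change q' - (c : ℂ) • (-1 / (B.τ : ℂ)) • ((B.κ : ℂ) • θx + (B.β : ℂ) • q') = q F
    refine smul_right_injective _ hτ ?_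
    change (B.τ : ℂ) • (q' - _) = (B.τ : ℂ) • q F
    have hk : (B.τ : ℂ) * ((c : ℂ) * (-1 / B.τ)) = -c := by field_simp
    rw [← eq, smul_sub, smul_smul, smul_smul, mul_assoc, hk]
    module


end Generation

/-! ### Surjectivity of `1 - c A` for both boundary conditions -/

section Range

open PhaseSpace

variable {B : Beam}

lemma re_inner_mulL2_ge {L : ℝ} {a : ℝ → ℝ} (hL : 0 < L) (ha : ContinuousOn a (Icc 0 L))
    (hpos : ∀ x ∈ Icc 0 L, 0 < a x) :
    ∃ c : ℝ, 0 < c ∧ ∀ f : L2 L, c * ‖f‖ ^ 2 ≤ (inner ℂ f (mulL2 a ha f)).re := by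
  obtain ⟨c, C, hc, hC, h⟩ := wform_bounds hL ha hpos
  exact ⟨c, hc, fun f => by simpa only [wform_eq_inner ha] using (h f).1⟩

/-- `1 - c A` is onto when `θ` vanishes at the ends: eliminate `q` and solve for `w` and `θ`. -/
lemma exists_sub_smul_eq_temperature {c : ℝ} (hc : 0 < c) (F : PhaseSpace B) :
    ∃ U : opDomain B .temperature, (U : PhaseSpace B) - (c : ℂ) • opFun U = F := by
  obtain ⟨em, hem, hm⟩ := re_inner_mulL2_ge B.L_pos B.m_cont B.m_pos
  obtain ⟨eδ, heδ, hδ⟩ := re_inner_mulL2_ge B.L_pos B.δ_cont B.δ_pos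
  have hp := re_inner_mulL2_nonneg B.L_pos B.p_cont B.p_pos
  have hκ := B.κ_pos
  have hs : 0 < B.τ + c * B.β := add_pos B.τ_pos (mul_pos hc B.β_pos)
  set s : ℝ := (B.τ + c * B.β)⁻¹ with hs_def
  have hs0 : 0 < s := inv_pos.mpr hs
  let P := fun i : Fin 4 => PiLp.proj (𝕜 := ℂ) 2 (fun _ : Fin 4 => L2 B.L) i
  let M : Fin 4 → Quad B.L →L[ℂ] L2 B.L :=
    -- The quadruple is `(w, w_x, θ, θ_x)`, with `u = u_F + c w` and `q = s (τ q_F - c κ θ_x)`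
    -- substituted. The two `c η` couplings cancel in the real part, so the form is coercive.
    ![mulCLM B.m B.m_cont ∘L P 0,
      (c : ℂ) • ((c : ℂ) • (mulCLM B.p B.p_cont ∘L P 1)
        + (2 : ℂ) • (mulCLM B.δ B.δ_cont ∘L P 1) - (B.η : ℂ) • P 2),
      P 2 + (c * B.η : ℂ) • P 1,
      ((c ^ 2 * B.κ ^ 2 * s : ℝ) : ℂ) • P 3]
  let R : Fin 4 → L2 B.L :=
    ![mulL2 B.m B.m_cont (w F), -(c : ℂ) • mulL2 B.p B.p_cont (dx0 B.L (u F)), θ F,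
      (c * B.κ * s * B.τ : ℂ) • q F]
  obtain ⟨v, r, z, hz0, hz1, hz2, hz3, hσ, hq⟩ := exists_weak_solution M
    (e := ![em, 2 * c * eδ, 1, c ^ 2 * B.κ ^ 2 * s])
    (fun i => by fin_cases i <;> simp <;> positivity) (fun z => by
      simp only [Fin.sum_univ_four, M, P]
      simp only [Matrix.cons_val, ContinuousLinearMap.comp_apply, smul_apply, add_apply, sub_apply,
        PiLp.proj_apply, mulCLM_apply, inner_add_right, inner_sub_right, inner_smul_right]
      have h1 := hm (z 0)
      have h2 := hδ (z 1)
      have h3 := hp (z 1)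
      have h4 := re_inner_self (z 2)
      have h5 := re_inner_self (z 3)
      have h6 : (inner ℂ (z 1) (z 2)).re = (inner ℂ (z 2) (z 1)).re :=
        inner_re_symm (𝕜 := ℂ) _ _
      simp only [Complex.add_re, Complex.sub_re, Complex.re_ofReal_mul, mul_assoc, h4, h5, h6]
      have e₂ : ∀ z : ℂ, (2 * z).re = 2 * z.re := fun z => by simp
      rw [e₂]
      have h7 : 0 ≤ c * (c * (inner ℂ (z 1) (mulL2 B.p B.p_cont (z 1))).re) := by positivity
      have h8 := mul_le_mul_of_nonneg_left h2 (by positivity : 0 ≤ 2 * c)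
      linarith) R
  have hκ' : (B.κ : ℂ) ≠ 0 := by exact_mod_cast hκ.ne'
  have hc' : (c : ℂ) ≠ 0 := by exact_mod_cast hc.ne'
  have hs' : (s : ℂ) * (B.τ + c * B.β) = 1 := by
    rw [hs_def]
    push_cast
    exact inv_mul_cancel₀ (by exact_mod_cast hs.ne')
  -- The flux in the weak `θ`-equation is `-c κ q`, so that equation supplies `q_x`.
  have hqx : ((s : ℂ) • ((B.τ : ℂ) • q F - (c * B.κ : ℂ) • dx0 B.L r),
      -(c * B.κ : ℂ)⁻¹ • ((r : L2 B.L) + (c * B.η : ℂ) • dx0 B.L v - θ F)) ∈ weakGraph B.L := by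
    convert (weakGraph B.L).smul_mem (-(c * B.κ : ℂ)⁻¹) hq using 1
    refine Prod.ext ?_ ?_
    · simp only [M, R, P, Matrix.cons_val, smul_apply, PiLp.proj_apply, Prod.smul_mk, hz3]
      push_cast
      match_scalars <;> field_simp
    · simp only [M, R, P, Matrix.cons_val, smul_apply, add_apply, PiLp.proj_apply, Prod.smul_mk,
        hz1, hz2]
  refine exists_sub_smul_eq_of_weak hc F v r.2 (mem_H1_iff.mpr ⟨_, hqx⟩) ?_
    (closure_testGraph_le (dx0_mem r)) hqx ?_ ?_
  · convert hσ using 2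
    · simp only [M, R, P, Matrix.cons_val, smul_apply, add_apply, sub_apply,
        ContinuousLinearMap.comp_apply, PiLp.proj_apply, mulCLM_apply, hz1, hz2, stress, map_add,
        map_smul]
      module
    · simp only [M, R, P, Matrix.cons_val, ContinuousLinearMap.comp_apply, PiLp.proj_apply,
        mulCLM_apply, hz0]
  · match_scalars <;> field_simp <;> ring
  · match_scalars
    · linear_combination (B.τ : ℂ) * hs'
    · linear_combination (-(c * B.κ) : ℂ) * hs'

/-- `1 - c A` is onto when `q` vanishes at the ends: eliminate `θ` and solve for `w` and `q`. -/
lemma exists_sub_smul_eq_flux {c : ℝ} (hc : 0 < c) (F : PhaseSpace B) :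
    ∃ U : opDomain B .flux, (U : PhaseSpace B) - (c : ℂ) • opFun U = F := by
  obtain ⟨em, hem, hm⟩ := re_inner_mulL2_ge B.L_pos B.m_cont B.m_pos
  obtain ⟨eδ, heδ, hδ⟩ := re_inner_mulL2_ge B.L_pos B.δ_cont B.δ_pos
  have hp := re_inner_mulL2_nonneg B.L_pos B.p_cont B.p_pos
  have hκ := B.κ_pos
  have hη := B.η_pos
  have hs : 0 < B.τ + c * B.β := add_pos B.τ_pos (mul_pos hc B.β_pos)
  let P := fun i : Fin 4 => PiLp.proj (𝕜 := ℂ) 2 (fun _ : Fin 4 => L2 B.L) i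
  -- The quadruple is now `(w, w_x, q, q_x)`, and the `θ`-equation reads `θ = θ_F - Y`.
  let Y : Quad B.L →L[ℂ] L2 B.L := (c * B.κ : ℂ) • P 3 + (c * B.η : ℂ) • P 1
  let M : Fin 4 → Quad B.L →L[ℂ] L2 B.L :=
    ![mulCLM B.m B.m_cont ∘L P 0,
      (c : ℂ) • ((c : ℂ) • (mulCLM B.p B.p_cont ∘L P 1)
        + (2 : ℂ) • (mulCLM B.δ B.δ_cont ∘L P 1)) + (c * B.η : ℂ) • Y,
      ((B.τ + c * B.β : ℝ) : ℂ) • P 2,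
      (c * B.κ : ℂ) • Y]
  let R : Fin 4 → L2 B.L :=
    ![mulL2 B.m B.m_cont (w F),
      (c : ℂ) • ((B.η : ℂ) • θ F - mulL2 B.p B.p_cont (dx0 B.L (u F))),
      (B.τ : ℂ) • q F, (c * B.κ : ℂ) • θ F]
  -- The couplings produce `‖Y‖²`, which alone does not control `q_x`. Half of the viscous damping
  -- is spent on `w_x` to recover it; the two bounds on `t` make `2 t ‖Y‖² ≤ ‖Y‖²` and `2 t (c η)² ≤
  -- c eδ`.
  set t : ℝ := min (1 / 2) (eδ / (2 * c * B.η ^ 2))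
  have ht : 0 < t := lt_min (by norm_num) (by positivity)
  have ht1 : t ≤ 1 / 2 := min_le_left _ _
  have ht2 : t * (2 * c * B.η ^ 2) ≤ eδ :=
    (le_div_iff₀ (by positivity)).mp (min_le_right _ _)
  obtain ⟨v, r, z, hz0, hz1, hz2, hz3, hσ, hq⟩ := exists_weak_solution M
    (e := ![em, c * eδ, B.τ + c * B.β, t * (c * B.κ) ^ 2])
    (fun i => by fin_cases i <;> simp <;> positivity) (fun z => by
      have h1 := hm (z 0)
      have h2 := mul_le_mul_of_nonneg_left (hδ (z 1)) (by positivity : 0 ≤ 2 * c)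
      have h3 : 0 ≤ c * (c * (inner ℂ (z 1) (mulL2 B.p B.p_cont (z 1))).re) := by
        have := hp (z 1)
        positivity
      have h4 := re_inner_self (z 2)
      have h5 : c * B.η * (inner ℂ (z 1) (Y z)).re + c * B.κ * (inner ℂ (z 3) (Y z)).re
          = ‖Y z‖ ^ 2 := by
        have hy : Y z = ((c * B.κ : ℝ) : ℂ) • z 3 + ((c * B.η : ℝ) : ℂ) • z 1 := by simp [Y, P]
        rw [← re_inner_self]
        nth_rewrite 3 [hy]
        rw [inner_add_left, inner_smul_left, inner_smul_left, Complex.conj_ofReal,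
          Complex.conj_ofReal, Complex.add_re, Complex.re_ofReal_mul, Complex.re_ofReal_mul]
        ring
      have h6 : (c * B.κ) ^ 2 * ‖z 3‖ ^ 2 ≤ 2 * ‖Y z‖ ^ 2 + 2 * (c * B.η) ^ 2 * ‖z 1‖ ^ 2 := by
        have hy : ((c * B.κ : ℝ) : ℂ) • z 3 = Y z - ((c * B.η : ℝ) : ℂ) • z 1 := by simp [Y, P]
        have h := congrArg norm hy
        rw [norm_smul, Complex.norm_of_nonneg (by positivity)] at h
        have h' := norm_sub_le (Y z) (((c * B.η : ℝ) : ℂ) • z 1)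
        rw [← h, norm_smul, Complex.norm_of_nonneg (by positivity)] at h'
        calc (c * B.κ) ^ 2 * ‖z 3‖ ^ 2 = (c * B.κ * ‖z 3‖) ^ 2 := by ring
          _ ≤ (‖Y z‖ + c * B.η * ‖z 1‖) ^ 2 := by gcongr
          _ ≤ 2 * (‖Y z‖ ^ 2 + (c * B.η * ‖z 1‖) ^ 2) := add_sq_le
          _ = _ := by ring
      have h7 : t * (c * B.κ) ^ 2 * ‖z 3‖ ^ 2 ≤ ‖Y z‖ ^ 2 + c * eδ * ‖z 1‖ ^ 2 := by
        have a1 := mul_le_mul_of_nonneg_left h6 ht.le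
        have a2 := mul_le_mul_of_nonneg_right ht1 (by positivity : 0 ≤ 2 * ‖Y z‖ ^ 2)
        have a3 := mul_le_mul_of_nonneg_right ht2 (by positivity : 0 ≤ c * ‖z 1‖ ^ 2)
        linarith
      have e₂ : ∀ z : ℂ, (2 * z).re = 2 * z.re := fun z => by simp
      simp only [Fin.sum_univ_four, M, P]
      simp only [Matrix.cons_val, ContinuousLinearMap.comp_apply, smul_apply, add_apply,
        PiLp.proj_apply, mulCLM_apply, inner_add_right, inner_smul_right, Complex.add_re,
        Complex.re_ofReal_mul, mul_assoc, h4, e₂]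
      linarith) R
  have hκ' : (B.κ : ℂ) ≠ 0 := by exact_mod_cast hκ.ne'
  have hc' : (c : ℂ) ≠ 0 := by exact_mod_cast hc.ne'
  -- Here the flux in the weak `q`-equation is `-c κ θ`, so `θ`, eliminated as a mere `L²` function,
  -- turns out to lie in `H¹`.
  have hθx : (θ F - (c : ℂ) • ((B.κ : ℂ) • dx0 B.L r + (B.η : ℂ) • dx0 B.L v),
      -(c * B.κ : ℂ)⁻¹ • (((B.τ + c * B.β : ℝ) : ℂ) • (r : L2 B.L) - (B.τ : ℂ) • q F))
        ∈ weakGraph B.L := by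
    convert (weakGraph B.L).smul_mem (-(c * B.κ : ℂ)⁻¹) hq using 1
    refine Prod.ext ?_ ?_
    · simp only [M, R, P, Y, Matrix.cons_val, smul_apply, add_apply, PiLp.proj_apply,
        Prod.smul_mk, hz1, hz3]
      match_scalars <;> field_simp
    · simp only [M, R, P, Matrix.cons_val, smul_apply, PiLp.proj_apply, Prod.smul_mk, hz2]
  refine exists_sub_smul_eq_of_weak hc F v (mem_H1_iff.mpr ⟨_, hθx⟩) r.2 ?_ hθx
    (closure_testGraph_le (dx0_mem r)) ?_ ?_
  · convert hσ using 2
    · simp only [M, R, P, Y, Matrix.cons_val, smul_apply, add_apply,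
        ContinuousLinearMap.comp_apply, PiLp.proj_apply, mulCLM_apply, hz1, hz3, stress, map_add,
        map_smul]
      module
    · simp only [M, R, P, Matrix.cons_val, ContinuousLinearMap.comp_apply, PiLp.proj_apply,
        mulCLM_apply, hz0]
  · exact sub_add_cancel _ _
  · push_cast
    match_scalars <;> field_simp
    ring

theorem isMaximalDissipative_op (B : Beam) (bc : Boundary) :
    IsMaximalDissipative (op B bc) where
  re_inner_nonpos U := re_inner_op_nonpos U
  exists_sub_smul_eq c hc F := by
    cases bc with
    | temperature => exact exists_sub_smul_eq_temperature hc F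
    | flux => exact exists_sub_smul_eq_flux hc F

end Range

end Cattaneo

end

theorem theorem2p1 (B : Cattaneo.Beam) (bc : Cattaneo.Boundary) (U₀ : Cattaneo.PhaseSpace B) :
    (∃! U : C(NNReal, Cattaneo.PhaseSpace B),
      Cattaneo.IsMildSolution (Cattaneo.op B bc) U₀ U) ∧
    (U₀ ∈ (Cattaneo.op B bc).domain →
      ∀ U : C(NNReal, Cattaneo.PhaseSpace B), Cattaneo.IsMildSolution (Cattaneo.op B bc) U₀ U →
        Cattaneo.IsC1 U ∧ Cattaneo.IsContInDomain (Cattaneo.op B bc) U ∧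
          Cattaneo.IsStrongSolution (Cattaneo.op B bc) U₀ U) :=
  have hA := Cattaneo.isMaximalDissipative_op B bc
  ⟨hA.existsUnique_isMildSolution U₀, fun h _ hU => hA.regularity h hU⟩
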